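/- Let $d,n,k$ be nonnegative integers and let $\Omega\subset\mathbb R^d$ be the closure of a bounded open convex set. Let $\Lambda=(\Lambda_1,\Lambda_2)$ with $\Lambda_1\in\mathbb S^k_+$ (real symmetric positive semidefinite) and $\Lambda_2\in\mathbb S^n_{++}$ (real symmetric positive definite). Let $\mathsf D^*\Phi=D_0\Phi+\sum_{i=1}^d D_i\,\partial_i\Phi$, with linear maps $D_0,\dots,D_d:\mathbb S^n\to\mathbb R^{n\times k}$, be a linear differential operator of order at most one with constant coefficients such that $\mathsf D^*(I)=0$. Matrices carry the inner product $A\cdot B=\mathrm{tr}(A^{\mathrm T}B)$, and $\mathbb X=\mathbb S^n\times\mathbb R^{n\times k}\times\mathbb R^{n\times n}$. Define $J_\Lambda:\mathbb X\to[0,\infty]$ by $$J_\Lambda(X,Y,Z)=\sup\Big\{X\cdot A+Y\cdot B+Z\cdot C\;:\;(A,B,C)\in\mathbb X,\ A+\tfrac12 B\Lambda_1^2B^{\mathrm T}+\tfrac12 C\Lambda_2^2C^{\mathrm T}\preceq0\Big\},$$ and for an $\mathbb X$-valued Radon measure $\mu$ on a compact set $S$ put $\mathcal J_{\Lambda,S}(\mu)=\int_S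 J_\Lambda\big(\tfrac{d\mu}{d\lambda}\big)\,d\lambda$, where $\lambda$ is any finite positive measure with $|\mu|\ll\lambda$ (the value does not depend on $\lambda$). For $a<b$ let $Q_a^b=[a,b]\times\Omega$. For $\mathsf G_a,\mathsf G_b\in\mathcal M(\Omega,\mathbb S^n_+)$ let $\mathcal{CE}([a,b];\mathsf G_a,\mathsf G_b)$ be the set of $\mu=(\mathsf G,\mathsf q,\mathsf R)\in\mathcal M(Q_a^b,\mathbb X)$ such that $$\int_{Q_a^b}\partial_t\Phi\cdot d\mathsf G+\mathsf D^*\Phi\cdot d\mathsf q+\Phi\cdot d\mathsf R=\int_\Omega\Phi_b\cdot d\mathsf G_b-\int_\Omega\Phi_a\cdot d\mathsf G_a\qquad\text{for all }\Phi\in C^1(Q_a^b,\mathbb S^n),$$ where $\mathsf D^*$ acts on the space variable, and let $\mathcal{CE}_\infty([a,b];\mathsf G_a,\mathsf G_b)$ be its subset of elements with $\mathcal J_{\Lambda,Q_a^b}(\mu)<\infty$. Define $\mathrm{WB}_\Lambda(\mathsf G_0,\mathsf G_1)\in[0,\infty]$ by $$\mathrm{WB}_\Lambda(\mathsf G_0,\mathsf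 G_1)^2=\inf_{\mu\in\mathcal{CE}([0,1];\mathsf G_0,\mathsf G_1)}\mathcal J_{\Lambda,Q_0^1}(\mu).$$ A disintegration of $\mu\in\mathcal M(Q_a^b,\mathbb X)$ is a measurable family $(\mu_t)_{t\in[a,b]}$ in $\mathcal M(\Omega,\mathbb X)$ with $\mu=\int_a^b\delta_t\otimes\mu_t\,dt$; if it exists, it is unique up to a null set of times $t$. If $\mu$ has no disintegration, then $\int_a^b\mathcal J_{\Lambda,\Omega}(\mu_t)^{1/2}dt$ and $\int_a^b\mathcal J_{\Lambda,\Omega}(\mu_t)\,dt$ are understood to be $+\infty$. **Proposition.** Let $\mathsf G_0,\mathsf G_1\in\mathcal M(\Omega,\mathbb S^n_+)$. For any $b>a>0$, $$\mathrm{WB}_\Lambda(\mathsf G_0,\mathsf G_1)=\inf_{\mu\in\mathcal{CE}([a,b];\mathsf G_0,\mathsf G_1)}\int_a^b\mathcal J_{\Lambda,\Omega}(\mu_t)^{1/2}\,dt .$$ Moreover, every minimizer $\mu$ of the problem $$\inf_{\mu\in\mathcal{CE}_\infty([a,b];\mathsf G_0,\mathsf G_1)}(b-a)\int_a^b\mathcal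 J_{\Lambda,\Omega}(\mu_t)\,dt\tag{P$'$}$$ has a disintegration $(\mu_t)_{t\in[a,b]}$, and each of its disintegrations satisfies $$(b-a)\,\mathcal J_{\Lambda,\Omega}(\mu_t)^{1/2}=\mathrm{WB}_\Lambda(\mathsf G_0,\mathsf G_1)\qquad\text{for a.e. }t\in[a,b].$$ -/

import Mathlib

open MeasureTheory Set
open scoped ENNReal

noncomputable section

namespace WassersteinBures

/-- The space `ℝᵈ` with its Euclidean norm. -/
abbrev Space (d : ℕ) : Type := EuclideanSpace ℝ (Fin d)

/-- Real `p × q` matrices. -/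
abbrev Mat (p q : ℕ) : Type := Matrix (Fin p) (Fin q) ℝ

/-- The Frobenius inner product `A · B = tr(Aᵀ B)`. -/
def frob {p q : ℕ} (A B : Mat p q) : ℝ := (A.transpose * B).trace

/-! ### Matrix-valued measures -/

section Measures

variable {α : Type*} [MeasurableSpace α]

/-- The signed measure `ν_{ij}` of a matrix-valued measure `ν`. -/
def entry {p q : ℕ} (ν : VectorMeasure α (Mat p q)) (i : Fin p) (j : Fin q) : SignedMeasure α :=
  ν.mapRange (Matrix.entryLinearMap ℝ ℝ i j).toAddMonoidHom (continuous_id.matrix_elem i j)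

/-- The integral `∫ Φ · dν = ∑ᵢⱼ ∫ Φᵢⱼ dνᵢⱼ`. -/
def pairing {p q : ℕ} (Φ : α → Mat p q) (ν : VectorMeasure α (Mat p q)) : ℝ :=
  ∑ i, ∑ j, (entry ν i j).integral (fun x => Φ x i j) (ContinuousLinearMap.lsmul ℝ ℝ)

/-- `ν` is carried by `S`: the measures on a closed set `S ⊆ ℝᵐ` are identified with the measures on
`ℝᵐ` which are carried by `S`. -/
def CarriedBy {p q : ℕ} (ν : VectorMeasure α (Mat p q)) (S : Set α) : Prop :=
  ∀ A : Set α, MeasurableSet A → Disjoint A S → ν A = 0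

/-- `ν ∈ 𝓜(S, 𝕊ⁿ₊)`: the values of `ν` are symmetric positive semidefinite matrices, and `ν` is
carried by `S`. -/
def IsPSDMeasureOn {n : ℕ} (S : Set α) (ν : VectorMeasure α (Mat n n)) : Prop :=
  CarriedBy ν S ∧ ∀ A : Set α, MeasurableSet A → (ν A).PosSemidef

/-- The sum of the total variations of the entries of `ν`. It dominates `|ν|`. -/
def entryVariation {p q : ℕ} (ν : VectorMeasure α (Mat p q)) : Measure α :=
  ∑ i, ∑ j, (entry ν i j).totalVariation

/-- The density `dν/dlam`, entry by entry. -/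
def density {p q : ℕ} (ν : VectorMeasure α (Mat p q)) (lam : Measure α) (x : α) : Mat p q :=
  Matrix.of fun i j => (entry ν i j).rnDeriv lam x

end Measures

/-- A measure `μ = (G, q, R)` with values in `𝕏 = 𝕊ⁿ × ℝ^{n × k} × 𝕄ⁿ`. (A countably additive measure
with values in a finite-dimensional space has finite total variation.) -/
structure Triple (α : Type*) [MeasurableSpace α] (n k : ℕ) where
  /-- the component with values in the symmetric matrices -/
  G : VectorMeasure α (Mat n n)
  /-- the component with values in the `n × k` matrices -/
  q : VectorMeasure α (Mat n k)
  /-- the component with values in the `n × n` matrices -/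
  R : VectorMeasure α (Mat n n)
  symm : ∀ A : Set α, (G A).IsSymm

/-- `μ` is carried by `S`, that is, `μ ∈ 𝓜(S, 𝕏)`. -/
def Triple.CarriedBy {α : Type*} [MeasurableSpace α] {n k : ℕ} (μ : Triple α n k) (S : Set α) :
    Prop :=
  WassersteinBures.CarriedBy μ.G S ∧ WassersteinBures.CarriedBy μ.q S ∧
    WassersteinBures.CarriedBy μ.R S

/-! ### The action functional -/

/-- The closed convex set `𝓞_Λ` of all `(A, B, C) ∈ 𝕊ⁿ × ℝ^{n × k} × 𝕄ⁿ` with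
`A + ½ B Λ₁² Bᵀ + ½ C Λ₂² Cᵀ ≼ 0`. -/
def constraintSet {n k : ℕ} (Λ₁ : Mat k k) (Λ₂ : Mat n n) : Set (Mat n n × Mat n k × Mat n n) :=
  {p | p.1.IsSymm ∧
    (-(p.1 + (1 / 2 : ℝ) • (p.2.1 * Λ₁ ^ 2 * p.2.1.transpose)
      + (1 / 2 : ℝ) • (p.2.2 * Λ₂ ^ 2 * p.2.2.transpose))).PosSemidef}

/-- The conjugate of the indicator function of `𝓞_Λ`, that is, the support function
`J_Λ(X, Y, Z) = sup {X · A + Y · B + Z · C ; (A, B, C) ∈ 𝓞_Λ} ∈ [0, ∞]`.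
Since `(0, 0, 0) ∈ 𝓞_Λ`, truncating the negative values at `0` does not change the supremum. -/
def costDensity {n k : ℕ} (Λ₁ : Mat k k) (Λ₂ : Mat n n) (X : Mat n n) (Y : Mat n k) (Z : Mat n n) :
    ℝ≥0∞ :=
  ⨆ p ∈ constraintSet Λ₁ Λ₂, ENNReal.ofReal (frob X p.1 + frob Y p.2.1 + frob Z p.2.2)

/-- A reference measure that dominates all the components of `μ`. -/
def Triple.ref {α : Type*} [MeasurableSpace α] {n k : ℕ} (μ : Triple α n k) : Measure α :=
  entryVariation μ.G + entryVariation μ.q + entryVariation μ.R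

/-- The `Λ`-weighted action functional `𝓙_Λ(μ) = ∫ J_Λ(dμ/dλ) dλ`, where `λ` is a finite measure with
`|μ| ≪ λ`; as `J_Λ` is positively homogeneous, the choice of `λ` does not matter. For `μ` carried by
`S` this is `𝓙_{Λ,S}(μ)`. -/
def action {α : Type*} [MeasurableSpace α] {n k : ℕ} (Λ₁ : Mat k k) (Λ₂ : Mat n n)
    (μ : Triple α n k) : ℝ≥0∞ :=
  ∫⁻ x, costDensity Λ₁ Λ₂ (density μ.G μ.ref x) (density μ.q μ.ref x) (density μ.R μ.ref x) ∂μ.ref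

/-! ### The continuity equation -/

/-- The coefficients of a first-order linear differential operator `𝖣*` with constant coefficients
that sends functions with values in `𝕊ⁿ` to functions with values in `ℝ^{n × k}`. (A linear map on
`𝕊ⁿ` is given as the restriction of a linear map on `𝕄ⁿ`; the operator is applied to functions with
symmetric values only.) -/
structure DiffOp (d n k : ℕ) where
  /-- the coefficient of order zero -/
  zeroth : Mat n n →ₗ[ℝ] Mat n k
  /-- the coefficients of the partial derivatives -/
  first : Fin d → (Mat n n →ₗ[ℝ] Mat n k)

/-- `𝖣* Φ = D₀ Φ + ∑ᵢ Dᵢ (∂ᵢ Φ)`. -/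
def DiffOp.apply {d n k : ℕ} (D : DiffOp d n k) (Φ : Space d → Mat n n) (x : Space d) : Mat n k :=
  D.zeroth (Φ x) + ∑ i, D.first i
    (Matrix.of fun r s => fderiv ℝ (fun y => Φ y r s) x (EuclideanSpace.single i 1))

/-- The time-space domain `Q_a^b = [a, b] × Ω`. -/
def timeSpace {d : ℕ} (a b : ℝ) (Ω : Set (Space d)) : Set (ℝ × Space d) := Icc a b ×ˢ Ω

/-- Test functions: the continuously differentiable functions with values in `𝕊ⁿ`. For
`Ω` the closure of a bounded open convex set, `C¹(Q_a^b, 𝕊ⁿ)` consists of their restrictions. -/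
def IsTestFunction {d n : ℕ} (Φ : ℝ × Space d → Mat n n) : Prop :=
  (∀ p, (Φ p).IsSymm) ∧ ∀ i j, ContDiff ℝ 1 fun p => Φ p i j

/-- The set `𝓒𝓔([a, b]; Ga, Gb)` of the curves `μ = (G, q, R) ∈ 𝓜(Q_a^b, 𝕏)` that connect `Ga` and
`Gb`: `∂ₜ G + 𝖣 q = R^sym + δ_a ⊗ Ga - δ_b ⊗ Gb` in the weak sense. -/
def CE {d n k : ℕ} (D : DiffOp d n k) (Ω : Set (Space d)) (a b : ℝ)
    (Ga Gb : VectorMeasure (Space d) (Mat n n)) : Set (Triple (ℝ × Space d) n k) :=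
  {μ | μ.CarriedBy (timeSpace a b Ω) ∧
    ∀ Φ : ℝ × Space d → Mat n n, IsTestFunction Φ →
      pairing (fun p => Matrix.of fun i j => deriv (fun t => Φ (t, p.2) i j) p.1) μ.G
        + pairing (fun p => D.apply (fun x => Φ (p.1, x)) p.2) μ.q
        + pairing Φ μ.R
      = pairing (fun x => Φ (b, x)) Gb - pairing (fun x => Φ (a, x)) Ga}

/-- The set `𝓒𝓔_∞([a, b]; Ga, Gb)` of the curves with finite action. -/
def CEfin {d n k : ℕ} (Λ₁ : Mat k k) (Λ₂ : Mat n n) (D : DiffOp d n k) (Ω : Set (Space d)) (a b : ℝ)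
    (Ga Gb : VectorMeasure (Space d) (Mat n n)) : Set (Triple (ℝ × Space d) n k) :=
  {μ | μ ∈ CE D Ω a b Ga Gb ∧ action Λ₁ Λ₂ μ < ∞}

/-- The weighted Wasserstein-Bures distance, `WB_Λ(G₀, G₁)² = inf 𝓙_{Λ,Q}(μ)` over
`μ ∈ 𝓒𝓔([0, 1]; G₀, G₁)`. -/
def WB {d n k : ℕ} (Λ₁ : Mat k k) (Λ₂ : Mat n n) (D : DiffOp d n k) (Ω : Set (Space d))
    (G₀ G₁ : VectorMeasure (Space d) (Mat n n)) : ℝ≥0∞ :=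
  (⨅ μ ∈ CE D Ω 0 1 G₀ G₁, action Λ₁ Λ₂ μ) ^ (1 / 2 : ℝ)

/-! ### Disintegration in time, length and energy -/

/-- `ν = ∫_a^b δ_t ⊗ ν_t dt`: for every Borel set `A`, the function `t ↦ ν_t({x ; (t, x) ∈ A})` is
integrable (in particular measurable) on `[a, b]`, and its integral is `ν(A)`. -/
def Disintegrates {d p q : ℕ} (a b : ℝ) (ν : VectorMeasure (ℝ × Space d) (Mat p q))
    (νt : ℝ → VectorMeasure (Space d) (Mat p q)) : Prop :=
  ∀ A : Set (ℝ × Space d), MeasurableSet A → ∀ i j,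
    IntegrableOn (fun t => νt t (Prod.mk t ⁻¹' A) i j) (Icc a b) ∧
    ν A i j = ∫ t in Icc a b, νt t (Prod.mk t ⁻¹' A) i j

/-- `μ = ∫_a^b δ_t ⊗ μ_t dt` with measures `μ_t = (G_t, q_t, R_t) ∈ 𝓜(Ω, 𝕏)`. The family is
determined by `μ` for almost every `t`. -/
def IsDisintegration {d n k : ℕ} (Ω : Set (Space d)) (a b : ℝ) (μ : Triple (ℝ × Space d) n k)
    (μt : ℝ → Triple (Space d) n k) : Prop :=
  (∀ t ∈ Icc a b, (μt t).CarriedBy Ω) ∧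
    Disintegrates a b μ.G (fun t => (μt t).G) ∧
    Disintegrates a b μ.q (fun t => (μt t).q) ∧
    Disintegrates a b μ.R (fun t => (μt t).R)

/-- The length `∫_a^b 𝓙_{Λ,Ω}(μ_t)^{1/2} dt` of a curve `μ = ∫_a^b δ_t ⊗ μ_t dt`; it is `∞` if `μ`
has no disintegration with respect to `dt`. -/
def curveLength {d n k : ℕ} (Λ₁ : Mat k k) (Λ₂ : Mat n n) (Ω : Set (Space d)) (a b : ℝ)
    (μ : Triple (ℝ × Space d) n k) : ℝ≥0∞ :=
  ⨅ (μt : ℝ → Triple (Space d) n k) (_ : IsDisintegration Ω a b μ μt),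
    ∫⁻ t in Icc a b, action Λ₁ Λ₂ (μt t) ^ (1 / 2 : ℝ)

/-- The objective `(b - a) ∫_a^b 𝓙_{Λ,Ω}(μ_t) dt` of a curve `μ = ∫_a^b δ_t ⊗ μ_t dt`; it is `∞` if
`μ` has no disintegration with respect to `dt`. -/
def curveEnergy {d n k : ℕ} (Λ₁ : Mat k k) (Λ₂ : Mat n n) (Ω : Set (Space d)) (a b : ℝ)
    (μ : Triple (ℝ × Space d) n k) : ℝ≥0∞ :=
  ⨅ (μt : ℝ → Triple (Space d) n k) (_ : IsDisintegration Ω a b μ μt),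
    ENNReal.ofReal (b - a) * ∫⁻ t in Icc a b, action Λ₁ Λ₂ (μt t)

/-- `μ` minimizes the energy over `𝓒𝓔_∞([a, b]; G₀, G₁)`. -/
def IsEnergyMinimizer {d n k : ℕ} (Λ₁ : Mat k k) (Λ₂ : Mat n n) (D : DiffOp d n k)
    (Ω : Set (Space d)) (a b : ℝ) (G₀ G₁ : VectorMeasure (Space d) (Mat n n))
    (μ : Triple (ℝ × Space d) n k) : Prop :=
  μ ∈ CEfin Λ₁ Λ₂ D Ω a b G₀ G₁ ∧
    ∀ ν ∈ CEfin Λ₁ Λ₂ D Ω a b G₀ G₁, curveEnergy Λ₁ Λ₂ Ω a b μ ≤ curveEnergy Λ₁ Λ₂ Ω a b ν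

end WassersteinBures

end

open WassersteinBures

noncomputable section

namespace WassersteinBures

open Filter Topology ProbabilityTheory

/-! ### The cost density -/

/-! The constraint set is stable under `(A, B, C) ↦ (c²A, cB, cC)`, so multiplying `X` alone by `h >
0` multiplies the cost by `h⁻¹` (`costDensity_scale`). A change of time with derivative `r` turns
the densities `(X, Y, Z)` into `(r X, Y, Z)` and therefore the action into `∫ r(t)⁻¹ f(t) dt`, where
`f(t)` is the action of the slice at time `t` (`exists_timeChange`). Both halves of the statement
follow from this rule and the Cauchy-Schwarz inequality.

For constant `r` the rule says that (length of the interval) × (action) does not change under affine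
rescaling (`exists_rescale`). With `∫ √f ≤ ((b - a) ∫ f)^{1/2}` this bounds the infimum of the
lengths by `WB`. Conversely, for a curve of length `L`, the choice `r = (ε + √f)/c` with `c = L +
ε(b - a)` gives a curve on `[0, 1]` of action at most `cL`, and `ε → 0` yields `WB ≤ L`
(`WB_le_curveLength`). For a minimizer the chain `WB ≤ length ≤ √energy ≤ WB` collapses, and
equality in Cauchy-Schwarz makes `√f` constant almost everywhere.

Two analytic points support this. Slices must exist: finite cost makes `X` positive semidefinite,
and testing the continuity equation with `φ(t) I`, for which `𝖣*Φ = 0`, bounds the time marginal of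
`tr G` by a multiple of Lebesgue measure (`exists_marginal_bound`). Since finite cost also forces `Y
= Z = 0` where `X = 0`, the whole measure is absolutely continuous in time (`ac_of_cost_lt_top`).
Moreover `r` is merely integrable, so `Φ(s(t), x)` with `s' = r` need not be a test function. It is
approximated through continuous `gₘ → r` in `L¹`, and the same marginal bound controls the error
(`continuity_eq_timeChange`). -/

lemma frob_eq_sum {p q : ℕ} (A B : Mat p q) : frob A B = ∑ i, ∑ j, A i j * B i j := by
  rw [frob, Matrix.trace, Finset.sum_comm]
  simp [Matrix.mul_apply]

@[simp] lemma frob_zero_left {p q : ℕ} (B : Mat p q) : frob 0 B = 0 := by simp [frob]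

@[simp] lemma frob_zero_right {p q : ℕ} (B : Mat p q) : frob B 0 = 0 := by simp [frob]

lemma frob_smul_left {p q : ℕ} (c : ℝ) (A B : Mat p q) : frob (c • A) B = c * frob A B := by
  simp [frob]

lemma frob_smul_right {p q : ℕ} (c : ℝ) (A B : Mat p q) : frob A (c • B) = c * frob A B := by
  simp [frob]

lemma eq_zero_of_frob_self_nonpos {p q : ℕ} {A : Mat p q} (h : frob A A ≤ 0) : A = 0 := by
  rw [frob_eq_sum] at h
  have h0 : ∀ i, 0 ≤ ∑ j, A i j * A i j := fun i => Finset.sum_nonneg fun j _ => mul_self_nonneg _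
  ext i j
  have h1 : ∑ j, A i j * A i j ≤ ∑ i, ∑ j, A i j * A i j :=
    Finset.single_le_sum (f := fun i => ∑ j, A i j * A i j) (fun i _ => h0 i) (Finset.mem_univ i)
  have h2 : A i j * A i j ≤ ∑ j, A i j * A i j :=
    Finset.single_le_sum (f := fun j => A i j * A i j) (fun j _ => mul_self_nonneg _)
      (Finset.mem_univ j)
  exact mul_self_eq_zero.1 (le_antisymm (by linarith) (mul_self_nonneg _))

lemma frob_vecMulVec {n : ℕ} (X : Mat n n) (v : Fin n → ℝ) :
    frob X (Matrix.vecMulVec v v) = ∑ i, ∑ j, X i j * (v i * v j) := by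
  simp [frob_eq_sum, Matrix.vecMulVec_apply]

section Cost

variable {n k : ℕ} {Λ₁ : Mat k k} {Λ₂ : Mat n n}

/-- The terms in `B` and `C` are quadratic while `A` enters linearly, hence the weights 2, 1, 1.
This anisotropic scaling is the source of every time-change formula below. -/
lemma smul_mem_constraintSet {A : Mat n n} {B : Mat n k} {C : Mat n n}
    (h : (A, B, C) ∈ constraintSet Λ₁ Λ₂) (c : ℝ) :
    (c ^ 2 • A, c • B, c • C) ∈ constraintSet Λ₁ Λ₂ := by
  refine ⟨h.1.smul _, ?_⟩
  have := h.2.smul (sq_nonneg c)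
  convert this using 1
  simp only [Matrix.transpose_smul, Matrix.smul_mul, Matrix.mul_smul, smul_smul, smul_neg, smul_add]
  simp only [pow_two, mul_comm, mul_assoc]

lemma ofReal_le_costDensity {X : Mat n n} {Y : Mat n k} {Z : Mat n n}
    {A : Mat n n} {B : Mat n k} {C : Mat n n} (h : (A, B, C) ∈ constraintSet Λ₁ Λ₂) :
    ENNReal.ofReal (frob X A + frob Y B + frob Z C) ≤ costDensity Λ₁ Λ₂ X Y Z :=
  le_iSup₂ (f := fun (p : Mat n n × Mat n k × Mat n n) (_ : p ∈ constraintSet Λ₁ Λ₂) =>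
    ENNReal.ofReal (frob X p.1 + frob Y p.2.1 + frob Z p.2.2)) (A, B, C) h

@[simp] lemma costDensity_zero : costDensity Λ₁ Λ₂ 0 0 0 = 0 := by
  simp [costDensity]

/-- Joint homogeneity of degree one is what makes the action independent of the reference measure.
-/
lemma costDensity_smul {c : ℝ} (hc : 0 ≤ c) (X : Mat n n) (Y : Mat n k) (Z : Mat n n) :
    costDensity Λ₁ Λ₂ (c • X) (c • Y) (c • Z) = ENNReal.ofReal c * costDensity Λ₁ Λ₂ X Y Z := by
  simp only [costDensity, frob_smul_left, ENNReal.mul_iSup, ← ENNReal.ofReal_mul hc, mul_add]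

/-- For admissible `(A, B, C)`, `hX·A + Y·B + Z·C = h⁻¹ (X·h²A + Y·hB + Z·hC)`, and the scaled
triple is again admissible. -/
lemma costDensity_scale_le {h : ℝ} (hh : 0 < h) (X : Mat n n) (Y : Mat n k) (Z : Mat n n) :
    costDensity Λ₁ Λ₂ (h • X) Y Z ≤ ENNReal.ofReal h⁻¹ * costDensity Λ₁ Λ₂ X Y Z := by
  refine iSup₂_le fun p hp => ?_
  refine le_trans (le_of_eq ?_) (mul_le_mul_right (ofReal_le_costDensity
    (smul_mem_constraintSet (A := p.1) (B := p.2.1) (C := p.2.2) hp h)) _)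
  rw [← ENNReal.ofReal_mul (inv_nonneg.2 hh.le)]
  simp only [frob_smul_left, frob_smul_right]
  congr 1
  field_simp

lemma costDensity_scale {h : ℝ} (hh : 0 < h) (X : Mat n n) (Y : Mat n k) (Z : Mat n n) :
    costDensity Λ₁ Λ₂ (h • X) Y Z = ENNReal.ofReal h⁻¹ * costDensity Λ₁ Λ₂ X Y Z := by
  refine le_antisymm (costDensity_scale_le hh X Y Z) ?_
  -- The reverse inequality is the same bound for the factor `h⁻¹`, applied to `h • X`.
  have h1 := costDensity_scale_le (Λ₁ := Λ₁) (Λ₂ := Λ₂) (inv_pos.2 hh) (h • X) Y Z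
  rw [smul_smul, inv_mul_cancel₀ hh.ne', one_smul, inv_inv] at h1
  refine (mul_le_mul_right h1 _).trans ?_
  rw [← mul_assoc, ← ENNReal.ofReal_mul (inv_nonneg.2 hh.le), inv_mul_cancel₀ hh.ne']
  simp

/-- The supremum is uncountable, so measurability comes from lower semicontinuity: each competitor
contributes a continuous function of the entries. -/
lemma measurable_costDensity {α : Type*} [MeasurableSpace α] {X : α → Mat n n} {Y : α → Mat n k}
    {Z : α → Mat n n} (hX : ∀ i j, Measurable fun x => X x i j)
    (hY : ∀ i j, Measurable fun x => Y x i j) (hZ : ∀ i j, Measurable fun x => Z x i j) :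
    Measurable fun x => costDensity Λ₁ Λ₂ (X x) (Y x) (Z x) := by
  have hlsc : LowerSemicontinuous fun w : (Fin n → Fin n → ℝ) × (Fin n → Fin k → ℝ) ×
      (Fin n → Fin n → ℝ) =>
        costDensity Λ₁ Λ₂ (Matrix.of w.1) (Matrix.of w.2.1) (Matrix.of w.2.2) := by
    refine lowerSemicontinuous_biSup fun p _ => Continuous.lowerSemicontinuous ?_
    simp only [frob_eq_sum, Matrix.of_apply]
    refine ENNReal.continuous_ofReal.comp ?_
    fun_prop
  refine hlsc.measurable.comp (f := fun x => ((fun i j => X x i j), (fun i j => Y x i j),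
    (fun i j => Z x i j))) ?_
  refine Measurable.prodMk ?_ (Measurable.prodMk ?_ ?_) <;>
    exact measurable_pi_lambda _ fun i => measurable_pi_lambda _ fun j => by
      first | exact hX i j | exact hY i j | exact hZ i j

/-! ### Consequences of finite cost -/

lemma nonpos_of_forall_mul_le {c M : ℝ} (h : ∀ s : ℝ, 0 < s → s * c ≤ M) : c ≤ 0 := by
  by_contra hc
  push Not at hc
  have hM : 0 ≤ max M 0 := le_max_right _ _
  have h1 := h ((max M 0 + 1) / c) (by positivity)
  rw [div_mul_cancel₀ _ hc.ne'] at h1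
  linarith [le_max_left M 0]

lemma frob_le_toReal_costDensity {X : Mat n n} {Y : Mat n k} {Z : Mat n n}
    (hJ : costDensity Λ₁ Λ₂ X Y Z < ∞)
    {A : Mat n n} {B : Mat n k} {C : Mat n n} (h : (A, B, C) ∈ constraintSet Λ₁ Λ₂) :
    frob X A + frob Y B + frob Z C ≤ (costDensity Λ₁ Λ₂ X Y Z).toReal :=
  (ENNReal.ofReal_le_iff_le_toReal hJ.ne).1 (ofReal_le_costDensity h)

/-- The ray `(-s v vᵀ, 0, 0)`, `s > 0`, is admissible, so a finite supremum forces `X · v vᵀ ≥ 0`.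
-/
lemma quadForm_nonneg_of_costDensity_lt_top {X : Mat n n} {Y : Mat n k} {Z : Mat n n}
    (hJ : costDensity Λ₁ Λ₂ X Y Z < ∞) (v : Fin n → ℝ) :
    0 ≤ ∑ i, ∑ j, X i j * (v i * v j) := by
  rw [← frob_vecMulVec, ← neg_nonpos]
  refine nonpos_of_forall_mul_le (M := (costDensity Λ₁ Λ₂ X Y Z).toReal) fun s hs => ?_
  have hmem : ((-s) • Matrix.vecMulVec v v, (0 : Mat n k), (0 : Mat n n)) ∈
      constraintSet Λ₁ Λ₂ := by
    refine ⟨?_, ?_⟩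
    · refine Matrix.IsSymm.smul ?_ _
      ext i j
      simp [Matrix.vecMulVec_apply, mul_comm]
    · have := (Matrix.posSemidef_vecMulVec_self_star v).smul hs.le
      simpa using this
  have := frob_le_toReal_costDensity hJ hmem
  simp only [frob_smul_right, frob_zero_right] at this
  linarith

lemma diag_nonneg_of_costDensity_lt_top {X : Mat n n} {Y : Mat n k} {Z : Mat n n}
    (hJ : costDensity Λ₁ Λ₂ X Y Z < ∞) (i : Fin n) : 0 ≤ X i i := by
  have := quadForm_nonneg_of_costDensity_lt_top hJ (Pi.single i 1)
  simpa [Pi.single_apply] using this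

/-- The vectors `eᵢ ± eⱼ` give `2|Xᵢⱼ| ≤ Xᵢᵢ + Xⱼⱼ`, and the diagonal is nonnegative. A bound on the
trace thus controls all of `X`. -/
lemma abs_le_trace_of_costDensity_lt_top {X : Mat n n} {Y : Mat n k} {Z : Mat n n}
    (hX : X.IsSymm) (hJ : costDensity Λ₁ Λ₂ X Y Z < ∞) (i j : Fin n) : |X i j| ≤ X.trace := by
  have hd := diag_nonneg_of_costDensity_lt_top hJ
  have h1 : ∀ i, X i i ≤ X.trace := fun i =>
    Finset.single_le_sum (f := fun i => X i i) (fun i _ => hd i) (Finset.mem_univ i)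
  have hs : X j i = X i j := hX.apply i j
  by_cases hij : i = j
  · subst hij
    rw [abs_of_nonneg (hd i)]
    exact h1 i
  have hp := quadForm_nonneg_of_costDensity_lt_top hJ (Pi.single i 1 + Pi.single j 1)
  have hm := quadForm_nonneg_of_costDensity_lt_top hJ (Pi.single i 1 - Pi.single j 1)
  simp only [Pi.add_apply, Pi.sub_apply, mul_add, add_mul, mul_sub, sub_mul,
    Finset.sum_add_distrib, Finset.sum_sub_distrib, Pi.single_apply] at hp hm
  simp at hp hm
  rw [abs_le]
  constructor <;> linarith [h1 i, h1 j]

lemma mem_constraintSet_left (hΛ₁ : Λ₁.PosSemidef) (Y : Mat n k) :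
    (-((1 / 2 : ℝ) • (Y * Λ₁ ^ 2 * Y.transpose)), Y, (0 : Mat n n)) ∈ constraintSet Λ₁ Λ₂ := by
  refine ⟨?_, by simpa using Matrix.PosSemidef.zero⟩
  have h : Λ₁.transpose = Λ₁ := by simpa using hΛ₁.isHermitian.eq
  simp [Matrix.IsSymm, Matrix.transpose_mul, Matrix.transpose_pow, h, Matrix.mul_assoc]

lemma mem_constraintSet_right (hΛ₂ : Λ₂.PosSemidef) (Z : Mat n n) :
    (-((1 / 2 : ℝ) • (Z * Λ₂ ^ 2 * Z.transpose)), (0 : Mat n k), Z) ∈ constraintSet Λ₁ Λ₂ := by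
  refine ⟨?_, by simpa using Matrix.PosSemidef.zero⟩
  have h : Λ₂.transpose = Λ₂ := by simpa using hΛ₂.isHermitian.eq
  simp [Matrix.IsSymm, Matrix.transpose_mul, Matrix.transpose_pow, h, Matrix.mul_assoc]

/-- When `X = 0` the component `A` is free of charge, so it can compensate `B = sY` (or `C = sZ`)
for every `s`; then `s |Y|²` is bounded in `s`. -/
lemma eq_zero_of_costDensity_lt_top (hΛ₁ : Λ₁.PosSemidef) (hΛ₂ : Λ₂.PosSemidef)
    {Y : Mat n k} {Z : Mat n n} (hJ : costDensity Λ₁ Λ₂ 0 Y Z < ∞) : Y = 0 ∧ Z = 0 := by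
  constructor
  · refine eq_zero_of_frob_self_nonpos (nonpos_of_forall_mul_le
      (M := (costDensity Λ₁ Λ₂ 0 Y Z).toReal) fun s _ => ?_)
    have := frob_le_toReal_costDensity hJ
      (smul_mem_constraintSet (mem_constraintSet_left (Λ₂ := Λ₂) hΛ₁ Y) s)
    simpa [frob_smul_right] using this
  · refine eq_zero_of_frob_self_nonpos (nonpos_of_forall_mul_le
      (M := (costDensity Λ₁ Λ₂ 0 Y Z).toReal) fun s _ => ?_)
    have := frob_le_toReal_costDensity hJ
      (smul_mem_constraintSet (mem_constraintSet_right (Λ₁ := Λ₁) hΛ₂ Z) s)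
    simpa [frob_smul_right] using this

end Cost

/-! ### Matrix-valued measures with a density -/

section Density

variable {α : Type*} [MeasurableSpace α]

@[simp] lemma entry_apply {p q : ℕ} (ν : VectorMeasure α (Mat p q)) (i : Fin p) (j : Fin q)
    (A : Set α) : entry ν i j A = ν A i j := rfl

/-- `ν = X lam`, entry by entry. -/
structure HasDensity {p q : ℕ} (ν : VectorMeasure α (Mat p q)) (lam : Measure α)
    (X : α → Mat p q) : Prop where
  meas : ∀ i j, Measurable fun x => X x i j
  int : ∀ i j, Integrable (fun x => X x i j) lam
  eq : ∀ i j, entry ν i j = lam.withDensityᵥ fun x => X x i j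

/-- The matrix-valued measure `X lam`. -/
def ofDensity {p q : ℕ} (lam : Measure α) (X : α → Mat p q) : VectorMeasure α (Mat p q) where
  measureOf' A := Matrix.of fun i j => lam.withDensityᵥ (fun x => X x i j) A
  empty' := by ext; simp
  not_measurable' A hA := by
    ext i j
    simp [VectorMeasure.not_measurable _ hA]
  m_iUnion' f hf hd := by
    refine Pi.hasSum.2 fun i => Pi.hasSum.2 fun j => ?_
    exact (lam.withDensityᵥ fun x => X x i j).m_iUnion hf hd

lemma ofDensity_apply {p q : ℕ} (lam : Measure α) (X : α → Mat p q) (A : Set α) (i : Fin p)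
    (j : Fin q) : ofDensity lam X A i j = lam.withDensityᵥ (fun x => X x i j) A := rfl

lemma hasDensity_ofDensity {p q : ℕ} {lam : Measure α} {X : α → Mat p q}
    (hm : ∀ i j, Measurable fun x => X x i j) (hi : ∀ i j, Integrable (fun x => X x i j) lam) :
    HasDensity (ofDensity lam X) lam X := ⟨hm, hi, fun _ _ => rfl⟩

lemma ofDensity_isSymm {n : ℕ} {lam : Measure α} {X : α → Mat n n} (hX : ∀ x, (X x).IsSymm)
    (A : Set α) : (ofDensity lam X A).IsSymm := by
  ext i j
  simp only [Matrix.transpose_apply, ofDensity_apply]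
  congr 2
  ext x
  exact (hX x).apply i j

lemma withDensityᵥ_apply_eq_zero_of_eqOn {lam : Measure α} {f : α → ℝ} {A : Set α}
    (hA : MeasurableSet A) (h : ∀ x ∈ A, f x = 0) : lam.withDensityᵥ f A = 0 := by
  by_cases hf : Integrable f lam
  · rw [withDensityᵥ_apply hf hA]
    exact setIntegral_eq_zero_of_forall_eq_zero h
  -- For a non-integrable density `withDensityᵥ` is zero by convention.
  · simp [Measure.withDensityᵥ, hf]

lemma ofDensity_carriedBy {p q : ℕ} {lam : Measure α} {X : α → Mat p q} {S : Set α}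
    (hX : ∀ x, x ∉ S → X x = 0) : CarriedBy (ofDensity lam X) S := by
  intro A hA hAS
  ext i j
  rw [ofDensity_apply]
  refine withDensityᵥ_apply_eq_zero_of_eqOn hA fun x hx => ?_
  rw [hX x (disjoint_left.1 hAS hx)]
  rfl

lemma HasDensity.mono_ac {p q : ℕ} {ν : VectorMeasure α (Mat p q)} {lam lam' : Measure α}
    [SigmaFinite lam] [SigmaFinite lam'] {X : α → Mat p q} (h : HasDensity ν lam X)
    (hac : lam ≪ lam') : HasDensity ν lam' fun x => (lam.rnDeriv lam' x).toReal • X x where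
  meas i j := by
    have := h.meas i j
    have h2 := Measure.measurable_rnDeriv lam lam'
    simp only [Matrix.smul_apply]
    fun_prop
  int i j := by
    simp only [Matrix.smul_apply]
    exact (integrable_rnDeriv_smul_iff hac).2 (h.int i j)
  eq i j := by
    simp only [Matrix.smul_apply]
    rw [h.eq, withDensityᵥ_rnDeriv_smul hac (h.int i j)]

lemma HasDensity.ae_eq {p q : ℕ} {ν : VectorMeasure α (Mat p q)} {lam : Measure α}
    {X X' : α → Mat p q} (h : HasDensity ν lam X) (h' : HasDensity ν lam X') : X =ᵐ[lam] X' := by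
  have : ∀ᵐ x ∂lam, ∀ i j, X x i j = X' x i j :=
    ae_all_iff.2 fun i => ae_all_iff.2 fun j =>
      (h.int i j).ae_eq_of_withDensityᵥ_eq (h'.int i j) (by rw [← h.eq, ← h'.eq])
  filter_upwards [this] with x hx
  ext i j
  exact hx i j

lemma variation_entry {p q : ℕ} {ν : VectorMeasure α (Mat p q)} {lam : Measure α}
    {X : α → Mat p q} (h : HasDensity ν lam X) (i : Fin p) (j : Fin q) :
    (entry ν i j).totalVariation = lam.withDensity fun x => ‖X x i j‖ₑ := by
  rw [SignedMeasure.totalVariation_eq_variation, h.eq,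
    Measure.variation_withDensityᵥ (h.int i j)]

lemma HasDensity.entryVariation_ac {p q : ℕ} {ν : VectorMeasure α (Mat p q)} {lam : Measure α}
    {X : α → Mat p q} (h : HasDensity ν lam X) : entryVariation ν ≪ lam := by
  refine Measure.AbsolutelyContinuous.mk fun A hA h0 => ?_
  simp only [entryVariation, Measure.coe_finsetSum, Finset.sum_apply, variation_entry h]
  exact Finset.sum_eq_zero fun i _ => Finset.sum_eq_zero fun j _ =>
    withDensity_absolutelyContinuous _ _ h0

instance {p q : ℕ} (ν : VectorMeasure α (Mat p q)) : IsFiniteMeasure (entryVariation ν) := by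
  unfold entryVariation
  infer_instance

lemma entry_totalVariation_le {p q : ℕ} (ν : VectorMeasure α (Mat p q)) (i : Fin p) (j : Fin q) :
    (entry ν i j).totalVariation ≤ entryVariation ν := by
  intro A
  simp only [entryVariation, Measure.coe_finsetSum, Finset.sum_apply]
  exact (Finset.single_le_sum (f := fun j => (entry ν i j).totalVariation A)
    (fun _ _ => zero_le) (Finset.mem_univ j)).trans
    (Finset.single_le_sum (f := fun i => ∑ j, (entry ν i j).totalVariation A)
    (fun _ _ => zero_le) (Finset.mem_univ i))

lemma hasDensity_density {p q : ℕ} (ν : VectorMeasure α (Mat p q)) {lam : Measure α}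
    [SigmaFinite lam] (hac : entryVariation ν ≪ lam) : HasDensity ν lam (density ν lam) where
  meas i j := by
    simp only [density, Matrix.of_apply]
    exact SignedMeasure.measurable_rnDeriv _ _
  int i j := by
    simp only [density, Matrix.of_apply]
    exact SignedMeasure.integrable_rnDeriv _ _
  eq i j := by
    simp only [density, Matrix.of_apply]
    refine (SignedMeasure.withDensityᵥ_rnDeriv_eq _ _ ?_).symm
    rw [SignedMeasure.absolutelyContinuous_ennreal_iff]
    have : lam.toENNRealVectorMeasure.ennrealToMeasure = lam :=
      VectorMeasure.equivMeasure.right_inv lam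
    rw [this]
    exact (entry_totalVariation_le ν i j).absolutelyContinuous.trans hac

/-- Splitting `w` into positive and negative parts reduces the integral to two finite positive
measures, where it is the ordinary one. -/
lemma integral_withDensityᵥ {lam : Measure α} {w f : α → ℝ} (hw : Integrable w lam)
    (hwm : Measurable w) (hfm : Measurable f) (hf : Integrable (fun x => f x * w x) lam) :
    (lam.withDensityᵥ w).integral f (ContinuousLinearMap.lsmul ℝ ℝ) = ∫ x, f x * w x ∂lam := by
  have h1 := isFiniteMeasure_withDensity_ofReal hw.2
  have h2 := isFiniteMeasure_withDensity_ofReal hw.neg.2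
  -- Used for `v = w` and `v = -w`; the bound `|v| ≤ |w|` transfers integrability from `f * w`.
  have key : ∀ v : α → ℝ, Measurable v → (∀ x, |v x| ≤ |w x|) →
      ∀ h : IsFiniteMeasure (lam.withDensity fun x => ENNReal.ofReal (v x)),
      VectorMeasure.Integrable ((lam.withDensity fun x => ENNReal.ofReal (v x)).toSignedMeasure) f ∧
      ((lam.withDensity fun x => ENNReal.ofReal (v x)).toSignedMeasure).integral f
        (ContinuousLinearMap.lsmul ℝ ℝ) = ∫ x, max (v x) 0 * f x ∂lam := by
    intro v hv hvw h
    have hi : Integrable (fun x => f x) (lam.withDensity fun x => ENNReal.ofReal (v x)) := by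
      rw [integrable_withDensity_iff (by fun_prop) (by simp)]
      refine hf.mono (by fun_prop) (ae_of_all _ fun x => ?_)
      simp only [norm_mul, Real.norm_eq_abs]
      refine mul_le_mul_of_nonneg_left (le_trans ?_ (hvw x)) (abs_nonneg _)
      rw [ENNReal.toReal_ofReal', abs_of_nonneg (le_max_right _ _)]
      exact max_le (le_abs_self _) (abs_nonneg _)
    refine ⟨by simpa [VectorMeasure.Integrable, Measure.variation_toSignedMeasure] using hi, ?_⟩
    have : ((lam.withDensity fun x => ENNReal.ofReal (v x)).toSignedMeasure).integral f
        (ContinuousLinearMap.lsmul ℝ ℝ) =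
        ∫ x, f x ∂(lam.withDensity fun x => ENNReal.ofReal (v x)) := by
      rw [← VectorMeasure.integral_toSignedMeasure]
      congr 1
      ext
      simp
    rw [this, integral_withDensity_eq_integral_toReal_smul (by fun_prop) (by simp)]
    simp [ENNReal.toReal_ofReal']
  obtain ⟨i1, e1⟩ := key w hwm (fun _ => le_rfl) h1
  obtain ⟨i2, e2⟩ := key (fun x => -w x) hwm.neg (fun _ => by rw [abs_neg]) h2
  rw [withDensityᵥ_eq_withDensity_pos_part_sub_withDensity_neg_part hw,
    VectorMeasure.integral_sub_vectorMeasure i1 i2, e1, e2, ← integral_sub]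
  · refine integral_congr_ae (ae_of_all _ fun x => ?_)
    simp only
    rw [← sub_mul, mul_comm]
    congr 1
    rcases le_total (w x) 0 with h | h
    · rw [max_eq_right h, max_eq_left (by linarith)]; ring
    · rw [max_eq_left h, max_eq_right (by linarith)]; ring
  · refine hf.mono (by fun_prop) (ae_of_all _ fun x => ?_)
    simp only [norm_mul, Real.norm_eq_abs]
    rw [mul_comm]
    refine mul_le_mul_of_nonneg_left ?_ (abs_nonneg _)
    rw [abs_of_nonneg (le_max_right _ _)]
    exact max_le (le_abs_self _) (abs_nonneg _)
  · refine hf.mono (by fun_prop) (ae_of_all _ fun x => ?_)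
    simp only [norm_mul, Real.norm_eq_abs]
    rw [mul_comm]
    refine mul_le_mul_of_nonneg_left ?_ (abs_nonneg _)
    rw [abs_of_nonneg (le_max_right _ _)]
    exact max_le (neg_le_abs _) (abs_nonneg _)

lemma HasDensity.pairing_eq {p q : ℕ} {ν : VectorMeasure α (Mat p q)} {lam : Measure α}
    {X Φ : α → Mat p q} (h : HasDensity ν lam X) (hm : ∀ i j, Measurable fun x => Φ x i j)
    (hi : ∀ i j, Integrable (fun x => Φ x i j * X x i j) lam) :
    pairing Φ ν = ∑ i, ∑ j, ∫ x, Φ x i j * X x i j ∂lam := by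
  refine Finset.sum_congr rfl fun i _ => Finset.sum_congr rfl fun j _ => ?_
  rw [h.eq, integral_withDensityᵥ (h.int i j) (h.meas i j) (hm i j) (hi i j)]

lemma HasDensity.ae_eq_zero_of_carriedBy {p q : ℕ} {ν : VectorMeasure α (Mat p q)}
    {lam : Measure α} {X : α → Mat p q} (h : HasDensity ν lam X) {S : Set α}
    (hS : MeasurableSet S) (hc : CarriedBy ν S) : ∀ᵐ x ∂lam, x ∉ S → X x = 0 := by
  have : ∀ᵐ x ∂lam, ∀ i j, x ∈ Sᶜ → X x i j = 0 := by
    refine ae_all_iff.2 fun i => ae_all_iff.2 fun j => ?_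
    refine (ae_restrict_iff' hS.compl).1 ?_
    refine Integrable.ae_eq_zero_of_forall_setIntegral_eq_zero (h.int i j).integrableOn
      fun A hA _ => ?_
    rw [Measure.restrict_restrict hA, ← withDensityᵥ_apply (h.int i j) (hA.inter hS.compl),
      ← h.eq, entry_apply, hc _ (hA.inter hS.compl)
      (disjoint_left.2 fun x hx hxS => hx.2 hxS)]
    rfl
  filter_upwards [this] with x hx hxS
  ext i j
  exact hx i j hxS

lemma HasDensity.congr {p q : ℕ} {ν : VectorMeasure α (Mat p q)} {lam : Measure α}
    {X X' : α → Mat p q} (h : HasDensity ν lam X) (hm : ∀ i j, Measurable fun x => X' x i j)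
    (he : X =ᵐ[lam] X') : HasDensity ν lam X' where
  meas := hm
  int i j := (h.int i j).congr (he.mono fun x hx => by simp only [hx])
  eq i j := (h.eq i j).trans (WithDensityᵥEq.congr_ae (he.mono fun x hx => by simp only [hx]))

/-! ### Triples of measures and invariance of the action -/

variable {n k : ℕ}

/-- `μ = (X, Y, Z) lam`. -/
structure Triple.HasDensity (μ : Triple α n k) (lam : Measure α) (X : α → Mat n n)
    (Y : α → Mat n k) (Z : α → Mat n n) : Prop where
  G : WassersteinBures.HasDensity μ.G lam X
  q : WassersteinBures.HasDensity μ.q lam Y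
  R : WassersteinBures.HasDensity μ.R lam Z

/-- The triple `(X, Y, Z) lam`. -/
def Triple.ofDensity (lam : Measure α) (X : α → Mat n n) (Y : α → Mat n k) (Z : α → Mat n n)
    (hX : ∀ x, (X x).IsSymm) : Triple α n k :=
  ⟨WassersteinBures.ofDensity lam X, WassersteinBures.ofDensity lam Y,
    WassersteinBures.ofDensity lam Z, ofDensity_isSymm hX⟩

lemma Triple.ext' {μ ν : Triple α n k} (hG : μ.G = ν.G) (hq : μ.q = ν.q) (hR : μ.R = ν.R) :
    μ = ν := by
  cases μ; cases ν
  simp_all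

instance (μ : Triple α n k) : IsFiniteMeasure μ.ref := by
  unfold Triple.ref
  infer_instance

lemma Triple.hasDensity_ref (μ : Triple α n k) :
    μ.HasDensity μ.ref (density μ.G μ.ref) (density μ.q μ.ref) (density μ.R μ.ref) where
  G := hasDensity_density _ (Measure.AbsolutelyContinuous.mk fun A _ h => by
    simp only [Triple.ref, Measure.coe_add, Pi.add_apply, add_eq_zero] at h; exact h.1.1)
  q := hasDensity_density _ (Measure.AbsolutelyContinuous.mk fun A _ h => by
    simp only [Triple.ref, Measure.coe_add, Pi.add_apply, add_eq_zero] at h; exact h.1.2)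
  R := hasDensity_density _ (Measure.AbsolutelyContinuous.mk fun A _ h => by
    simp only [Triple.ref, Measure.coe_add, Pi.add_apply, add_eq_zero] at h; exact h.2)

lemma Triple.HasDensity.ref_ac {μ : Triple α n k} {lam : Measure α} {X : α → Mat n n}
    {Y : α → Mat n k} {Z : α → Mat n n} (h : μ.HasDensity lam X Y Z) : μ.ref ≪ lam := by
  refine Measure.AbsolutelyContinuous.mk fun A _ h0 => ?_
  simp [Triple.ref, h.G.entryVariation_ac h0, h.q.entryVariation_ac h0, h.R.entryVariation_ac h0]

/-- The action does not depend on the reference measure. -/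
lemma Triple.HasDensity.action_eq {Λ₁ : Mat k k} {Λ₂ : Mat n n} {μ : Triple α n k}
    {lam : Measure α} [SigmaFinite lam] {X : α → Mat n n} {Y : α → Mat n k} {Z : α → Mat n n}
    (h : μ.HasDensity lam X Y Z) :
    action Λ₁ Λ₂ μ = ∫⁻ x, costDensity Λ₁ Λ₂ (X x) (Y x) (Z x) ∂lam := by
  have hac := h.ref_ac
  have hr := μ.hasDensity_ref
  have e1 := (hr.G.mono_ac hac).ae_eq h.G
  have e2 := (hr.q.mono_ac hac).ae_eq h.q
  have e3 := (hr.R.mono_ac hac).ae_eq h.R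
  have hm := measurable_costDensity (Λ₁ := Λ₁) (Λ₂ := Λ₂) hr.G.meas hr.q.meas hr.R.meas
  rw [action, ← lintegral_rnDeriv_mul hac hm.aemeasurable]
  refine lintegral_congr_ae ?_
  filter_upwards [e1, e2, e3, Measure.rnDeriv_lt_top μ.ref lam] with x h1 h2 h3 h4
  rw [← h1, ← h2, ← h3, costDensity_smul ENNReal.toReal_nonneg, ENNReal.ofReal_toReal h4.ne]

/-- On the common zero set of the densities all total variations vanish, and `μ.ref` is their sum.
Hence null-set statements about `μ` pass to `μ.ref`. -/
lemma Triple.ref_ae_ne_zero (μ : Triple α n k) {X : α → Mat n n} {Y : α → Mat n k}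
    {Z : α → Mat n n} (h : μ.HasDensity μ.ref X Y Z) :
    ∀ᵐ x ∂μ.ref, ¬ (X x = 0 ∧ Y x = 0 ∧ Z x = 0) := by
  have hm : ∀ {p q : ℕ} {W : α → Mat p q}, (∀ i j, Measurable fun x => W x i j) →
      MeasurableSet {x | W x = 0} := by
    intro p q W hW
    have : {x | W x = 0} = ⋂ i, ⋂ j, {x | W x i j = 0} := by
      ext x
      simp [← Matrix.ext_iff]
    rw [this]
    exact MeasurableSet.iInter fun i => MeasurableSet.iInter fun j =>
      hW i j (measurableSet_singleton 0)
  set E : Set α := {x | X x = 0} ∩ ({x | Y x = 0} ∩ {x | Z x = 0}) with hE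
  have hEm : MeasurableSet E := (hm h.G.meas).inter ((hm h.q.meas).inter (hm h.R.meas))
  have hv : ∀ {p q : ℕ} {ν : VectorMeasure α (Mat p q)} {W : α → Mat p q},
      WassersteinBures.HasDensity ν μ.ref W → (∀ x ∈ E, W x = 0) → entryVariation ν E = 0 := by
    intro p q ν W hW h0
    simp only [entryVariation, Measure.coe_finsetSum, Finset.sum_apply, variation_entry hW]
    refine Finset.sum_eq_zero fun i _ => Finset.sum_eq_zero fun j _ => ?_
    rw [withDensity_apply _ hEm]
    refine setLIntegral_eq_zero hEm fun x hx => ?_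
    simp [h0 x hx]
  have h0 : μ.ref E = 0 := by
    nth_rewrite 1 [Triple.ref]
    simp [hv h.G fun x hx => hx.1, hv h.q fun x hx => hx.2.1, hv h.R fun x hx => hx.2.2]
  exact measure_eq_zero_iff_ae_notMem.1 h0

/-- A measure on `S` has a density which is symmetric in the first component, vanishes off `S`, and
does not vanish almost everywhere on `S`. -/
lemma Triple.exists_density (μ : Triple α n k) {S : Set α} (hS : MeasurableSet S)
    (hc : μ.CarriedBy S) : ∃ (X : α → Mat n n) (Y : α → Mat n k) (Z : α → Mat n n),
      μ.HasDensity μ.ref X Y Z ∧ (∀ x, (X x).IsSymm) ∧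
      (∀ x, x ∉ S → X x = 0 ∧ Y x = 0 ∧ Z x = 0) ∧
      ∀ᵐ x ∂μ.ref, ¬ (X x = 0 ∧ Y x = 0 ∧ Z x = 0) := by
  classical
  have hr := μ.hasDensity_ref
  have hind : ∀ {p q : ℕ} {ν : VectorMeasure α (Mat p q)} {W : α → Mat p q},
      WassersteinBures.HasDensity ν μ.ref W → WassersteinBures.CarriedBy ν S →
      WassersteinBures.HasDensity ν μ.ref (S.indicator W) := by
    intro p q ν W hW hcν
    refine hW.congr (fun i j => ?_) ?_
    · have : (fun x => S.indicator W x i j) = S.indicator fun x => W x i j := by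
        ext x
        by_cases hx : x ∈ S <;> simp [hx]
      rw [this]
      exact (hW.meas i j).indicator hS
    · filter_upwards [hW.ae_eq_zero_of_carriedBy hS hcν] with x hx
      by_cases hxS : x ∈ S <;> simp [hxS, hx]
  have hd : μ.HasDensity μ.ref (S.indicator (density μ.G μ.ref)) (S.indicator (density μ.q μ.ref))
      (S.indicator (density μ.R μ.ref)) := ⟨hind hr.G hc.1, hind hr.q hc.2.1, hind hr.R hc.2.2⟩
  refine ⟨_, _, _, hd, fun x => ?_, fun x hx => by simp [hx], μ.ref_ae_ne_zero hd⟩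
  by_cases hx : x ∈ S
  · simp only [hx, indicator_of_mem]
    ext i j
    -- Symmetry holds at every point, not just almost everywhere: both entries are the derivative of
    -- one and the same signed measure.
    have : entry μ.G j i = entry μ.G i j := by
      ext A _
      exact (μ.symm A).apply i j
    simp [density, this]
  · simp [hx, Matrix.IsSymm]

end Density

/-! ### Disintegration in time -/

section Slice

variable {d : ℕ}

/-- Here `lam` is its time marginal composed with `condKernel`, and the marginal is `rnDeriv · dt`.
-/
lemma lintegral_slice {lam : Measure (ℝ × Space d)} [IsFiniteMeasure lam]
    (hac : lam.fst ≪ volume) {F : ℝ × Space d → ℝ≥0∞} (hF : Measurable F) :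
    ∫⁻ p, F p ∂lam =
      ∫⁻ t, lam.fst.rnDeriv volume t * ∫⁻ x, F (t, x) ∂lam.condKernel t := by
  rw [lintegral_rnDeriv_mul hac hF.lintegral_kernel_prod_right'.aemeasurable,
    Measure.lintegral_condKernel hF]

lemma ae_integrable_slice {lam : Measure (ℝ × Space d)} [IsFiniteMeasure lam]
    (hac : lam.fst ≪ volume) {w : ℝ × Space d → ℝ} (hw : Integrable w lam) :
    ∀ᵐ t : ℝ, Integrable (fun x => (lam.fst.rnDeriv volume t).toReal * w (t, x))
      (lam.condKernel t) := by
  have h1 := hw.condKernel_ae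
  rw [← Measure.withDensity_rnDeriv_eq _ _ hac,
    ae_withDensity_iff (Measure.measurable_rnDeriv _ _)] at h1
  filter_upwards [h1] with t ht
  -- Integrability under the kernel is known only where the marginal density is nonzero; elsewhere
  -- the factor kills the integrand.
  by_cases h0 : lam.fst.rnDeriv volume t = 0
  · simp [h0]
  · exact (ht h0).const_mul _

lemma integrable_slice {lam : Measure (ℝ × Space d)} [IsFiniteMeasure lam]
    (hac : lam.fst ≪ volume) {w : ℝ × Space d → ℝ} (hw : Integrable w lam) :
    Integrable fun t : ℝ => ∫ x, (lam.fst.rnDeriv volume t).toReal * w (t, x)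
      ∂lam.condKernel t := by
  simp_rw [integral_const_mul]
  exact (integrable_rnDeriv_smul_iff hac).2 hw.integral_condKernel

lemma integral_slice {lam : Measure (ℝ × Space d)} [IsFiniteMeasure lam]
    (hac : lam.fst ≪ volume) {w : ℝ × Space d → ℝ} (hw : Integrable w lam) :
    ∫ p, w p ∂lam = ∫ t : ℝ, ∫ x, (lam.fst.rnDeriv volume t).toReal * w (t, x)
      ∂lam.condKernel t := by
  simp_rw [integral_const_mul]
  rw [← Measure.integral_condKernel hw]
  exact (integral_rnDeriv_smul hac).symm

/-- The density of the slice at time `t`. -/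
def sliceDensity {p q : ℕ} (lam : Measure (ℝ × Space d)) [IsFiniteMeasure lam]
    (X : ℝ × Space d → Mat p q) (t : ℝ) (x : Space d) : Mat p q :=
  (lam.fst.rnDeriv volume t).toReal • X (t, x)

lemma ae_hasDensity_slice {p q : ℕ} {lam : Measure (ℝ × Space d)} [IsFiniteMeasure lam]
    (hac : lam.fst ≪ volume) {ν : VectorMeasure (ℝ × Space d) (Mat p q)}
    {X : ℝ × Space d → Mat p q} (h : HasDensity ν lam X) :
    ∀ᵐ t : ℝ, HasDensity (ofDensity (lam.condKernel t) (sliceDensity lam X t))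
      (lam.condKernel t) (sliceDensity lam X t) := by
  have h1 := ae_all_iff.2 fun i => ae_all_iff.2 fun j => ae_integrable_slice hac (h.int i j)
  filter_upwards [h1] with t ht
  refine hasDensity_ofDensity (fun i j => ?_) fun i j => ht i j
  exact ((h.meas i j).comp measurable_prodMk_left).const_mul _

lemma disintegrates_slice {p q : ℕ} {a b : ℝ} {Ω : Set (Space d)}
    {lam : Measure (ℝ × Space d)} [IsFiniteMeasure lam]
    (hac : lam.fst ≪ volume) {ν : VectorMeasure (ℝ × Space d) (Mat p q)}
    {X : ℝ × Space d → Mat p q} (h : HasDensity ν lam X)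
    (hX : ∀ p, p ∉ timeSpace a b Ω → X p = 0) :
    Disintegrates a b ν fun t => ofDensity (lam.condKernel t) (sliceDensity lam X t) := by
  intro A hA i j
  have hw : Integrable (A.indicator fun p => X p i j) lam := (h.int i j).indicator hA
  have hae : (fun t => ofDensity (lam.condKernel t) (sliceDensity lam X t)
      (Prod.mk t ⁻¹' A) i j) =ᵐ[volume] fun t => ∫ x, (lam.fst.rnDeriv volume t).toReal *
        A.indicator (fun p => X p i j) (t, x) ∂lam.condKernel t := by
    filter_upwards [ae_integrable_slice hac (h.int i j)] with t ht
    have hAt : MeasurableSet (Prod.mk t ⁻¹' A) := measurable_prodMk_left hA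
    rw [ofDensity_apply, withDensityᵥ_apply (by exact ht) hAt, ← integral_indicator hAt]
    congr 1
    ext x
    by_cases hx : (t, x) ∈ A <;> simp [hx, sliceDensity]
  have hi := (integrable_slice hac hw).congr hae.symm
  refine ⟨hi.integrableOn, ?_⟩
  rw [setIntegral_eq_integral_of_forall_compl_eq_zero, integral_congr_ae hae,
    ← integral_slice hac hw, integral_indicator hA, ← withDensityᵥ_apply (h.int i j) hA, ← h.eq,
    entry_apply]
  intro t ht
  refine withDensityᵥ_apply_eq_zero_of_eqOn (measurable_prodMk_left hA) fun x _ => ?_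
  simp [sliceDensity, hX (t, x) fun hp => ht hp.1]

/-- Testing on rectangles `N ×ˢ B` determines `t ↦ νt t B` almost everywhere for each fixed `B`.
Letting `B` run through a countable algebra that generates the Borel sets leaves a single null set
of times. -/
lemma Disintegrates.ae_unique {p q : ℕ} {a b : ℝ}
    {ν : VectorMeasure (ℝ × Space d) (Mat p q)}
    {νt νt' : ℝ → VectorMeasure (Space d) (Mat p q)}
    (h : Disintegrates a b ν νt) (h' : Disintegrates a b ν νt') :
    ∀ᵐ t ∂(volume.restrict (Icc a b)), νt t = νt' t := by
  set C : Set (Set (Space d)) :=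
    generateSetAlgebra (MeasurableSpace.countableGeneratingSet (Space d)) with hC
  have hCc : C.Countable :=
    countable_generateSetAlgebra (MeasurableSpace.countable_countableGeneratingSet)
  have hgen : (inferInstance : MeasurableSpace (Space d)) = MeasurableSpace.generateFrom C := by
    rw [hC, generateFrom_generateSetAlgebra_eq,
      MeasurableSpace.generateFrom_countableGeneratingSet]
  have hCm : ∀ B ∈ C, MeasurableSet B := fun B hB =>
    hgen.ge B (MeasurableSpace.measurableSet_generateFrom hB)
  have hCalg : IsSetAlgebra C := isSetAlgebra_generateSetAlgebra
  have key : ∀ B ∈ C, ∀ᵐ t ∂(volume.restrict (Icc a b)), νt t B = νt' t B := by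
    intro B hB
    have : ∀ᵐ t ∂(volume.restrict (Icc a b)), ∀ i j, νt t B i j = νt' t B i j := by
      refine ae_all_iff.2 fun i => ae_all_iff.2 fun j => ?_
      have e1 : ∀ {ρt : ℝ → VectorMeasure (Space d) (Mat p q)}, Disintegrates a b ν ρt →
          Integrable (fun t => ρt t B i j) (volume.restrict (Icc a b)) ∧
          ∀ N, MeasurableSet N → ∫ t in N, ρt t B i j ∂(volume.restrict (Icc a b)) =
            ν (N ×ˢ B) i j := by
        intro ρt hρ
        refine ⟨?_, fun N hN => ?_⟩
        · have := (hρ (univ ×ˢ B) (MeasurableSet.univ.prod (hCm B hB)) i j).1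
          simpa [IntegrableOn] using this
        · rw [(hρ (N ×ˢ B) (hN.prod (hCm B hB)) i j).2, ← integral_indicator hN]
          congr 1
          ext t
          by_cases ht : t ∈ N <;> simp [ht]
      exact Integrable.ae_eq_of_forall_setIntegral_eq _ _ (e1 h).1 (e1 h').1 fun N hN _ => by
        rw [(e1 h).2 N hN, (e1 h').2 N hN]
    filter_upwards [this] with t ht
    ext i j
    exact ht i j
  have key' := (ae_ball_iff hCc).2 key
  filter_upwards [key'] with t ht
  exact VectorMeasure.ext_of_generateFrom C ht hgen
    (fun s hs t ht _ => hCalg.inter_mem hs ht) (ht _ hCalg.univ_mem)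

variable {n k : ℕ}

/-- The action of the slice at time `t`. -/
def sliceAction (Λ₁ : Mat k k) (Λ₂ : Mat n n) (lam : Measure (ℝ × Space d)) [IsFiniteMeasure lam]
    (X : ℝ × Space d → Mat n n) (Y : ℝ × Space d → Mat n k) (Z : ℝ × Space d → Mat n n)
    (t : ℝ) : ℝ≥0∞ :=
  lam.fst.rnDeriv volume t *
    ∫⁻ x, costDensity Λ₁ Λ₂ (X (t, x)) (Y (t, x)) (Z (t, x)) ∂lam.condKernel t

/-- `μ = (X, Y, Z) lam` where `lam` is finite, `X` is symmetric, and `X`, `Y`, `Z` vanish off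
`[a, b] × Ω`, but not on a set of positive measure. -/
structure Triple.IsCurveDensity (Ω : Set (Space d)) (a b : ℝ) (μ : Triple (ℝ × Space d) n k)
    (lam : Measure (ℝ × Space d)) (X : ℝ × Space d → Mat n n) (Y : ℝ × Space d → Mat n k)
    (Z : ℝ × Space d → Mat n n) : Prop extends μ.HasDensity lam X Y Z where
  symm : ∀ p, (X p).IsSymm
  X_off : ∀ p, p ∉ timeSpace a b Ω → X p = 0
  Y_off : ∀ p, p ∉ timeSpace a b Ω → Y p = 0
  Z_off : ∀ p, p ∉ timeSpace a b Ω → Z p = 0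
  ae_ne_zero : ∀ᵐ p ∂lam, ¬ (X p = 0 ∧ Y p = 0 ∧ Z p = 0)

lemma Triple.exists_isCurveDensity {Ω : Set (Space d)} (hΩ : MeasurableSet Ω) {a b : ℝ}
    {μ : Triple (ℝ × Space d) n k} (hc : μ.CarriedBy (timeSpace a b Ω)) :
    ∃ X Y Z, μ.IsCurveDensity Ω a b μ.ref X Y Z := by
  obtain ⟨X, Y, Z, h, hs, h0, hne⟩ := μ.exists_density (measurableSet_Icc.prod hΩ) hc
  exact ⟨X, Y, Z, h, hs, fun p hp => (h0 p hp).1, fun p hp => (h0 p hp).2.1,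
    fun p hp => (h0 p hp).2.2, hne⟩

namespace Triple.IsCurveDensity

variable {Λ₁ : Mat k k} {Λ₂ : Mat n n} {Ω : Set (Space d)} {a b : ℝ}
  {μ : Triple (ℝ × Space d) n k} {lam : Measure (ℝ × Space d)}
  {X : ℝ × Space d → Mat n n} {Y : ℝ × Space d → Mat n k} {Z : ℝ × Space d → Mat n n}

lemma measurable_cost (h : μ.IsCurveDensity Ω a b lam X Y Z) :
    Measurable fun p => costDensity Λ₁ Λ₂ (X p) (Y p) (Z p) :=
  measurable_costDensity h.G.meas h.q.meas h.R.meas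

lemma measurable_cost_slice (h : μ.IsCurveDensity Ω a b lam X Y Z) (t : ℝ) :
    Measurable fun x => costDensity Λ₁ Λ₂ (X (t, x)) (Y (t, x)) (Z (t, x)) :=
  h.measurable_cost.comp measurable_prodMk_left

/-- Over a null set `N` of times the disintegration gives every part of `μ` mass zero, so `X`, `Y`,
`Z` vanish almost everywhere there; but almost nowhere do all three vanish. -/
lemma ac_of_isDisintegration (h : μ.IsCurveDensity Ω a b lam X Y Z)
    {μt : ℝ → Triple (Space d) n k} (ht : IsDisintegration Ω a b μ μt) :
    lam.fst ≪ volume := by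
  refine Measure.AbsolutelyContinuous.mk fun N hN h0 => ?_
  have hNm : MeasurableSet (Prod.fst ⁻¹' N : Set (ℝ × Space d)) := measurable_fst hN
  have key : ∀ {p q : ℕ} {ν : VectorMeasure (ℝ × Space d) (Mat p q)} {W : ℝ × Space d → Mat p q}
      {νt : ℝ → VectorMeasure (Space d) (Mat p q)}, WassersteinBures.HasDensity ν lam W →
      Disintegrates a b ν νt → ∀ᵐ p ∂lam, p ∈ (Prod.fst ⁻¹' N : Set (ℝ × Space d)) → W p = 0 := by
    intro p q ν W νt hW hν
    have : ∀ᵐ p ∂lam, ∀ i j, p ∈ (Prod.fst ⁻¹' N : Set (ℝ × Space d)) → W p i j = 0 := by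
      refine ae_all_iff.2 fun i => ae_all_iff.2 fun j => ?_
      refine (ae_restrict_iff' hNm).1 ?_
      refine Integrable.ae_eq_zero_of_forall_setIntegral_eq_zero (hW.int i j).integrableOn
        fun A hA _ => ?_
      rw [Measure.restrict_restrict hA, ← withDensityᵥ_apply (hW.int i j) (hA.inter hNm),
        ← hW.eq, entry_apply, (hν _ (hA.inter hNm) i j).2]
      refine integral_eq_zero_of_ae ?_
      filter_upwards [ae_restrict_of_ae (measure_eq_zero_iff_ae_notMem.1 h0)] with t ht
      have : Prod.mk t ⁻¹' (A ∩ Prod.fst ⁻¹' N) = (∅ : Set (Space d)) := by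
        ext x
        simp [ht]
      simp [this]
    filter_upwards [this] with p hp hpN
    ext i j
    exact hp i j hpN
  rw [Measure.fst_apply hN, measure_eq_zero_iff_ae_notMem]
  filter_upwards [key h.G ht.2.1, key h.q ht.2.2.1, key h.R ht.2.2.2, h.ae_ne_zero]
    with p h1 h2 h3 h4 hp
  exact h4 ⟨h1 hp, h2 hp, h3 hp⟩

variable [IsFiniteMeasure lam]

lemma measurable_sliceAction (h : μ.IsCurveDensity Ω a b lam X Y Z) :
    Measurable (sliceAction Λ₁ Λ₂ lam X Y Z) :=
  (Measure.measurable_rnDeriv _ _).mul (h.measurable_cost.lintegral_kernel_prod_right')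

lemma sliceAction_eq_zero (h : μ.IsCurveDensity Ω a b lam X Y Z) {t : ℝ} (ht : t ∉ Icc a b) :
    sliceAction Λ₁ Λ₂ lam X Y Z t = 0 := by
  have : ∀ x, (t, x) ∉ timeSpace a b Ω := fun x hp => ht hp.1
  simp [sliceAction, h.X_off _ (this _), h.Y_off _ (this _), h.Z_off _ (this _)]

lemma lintegral_mul_cost (h : μ.IsCurveDensity Ω a b lam X Y Z) (hac : lam.fst ≪ volume)
    {g : ℝ → ℝ≥0∞} (hg : Measurable g) :
    ∫⁻ p, g p.1 * costDensity Λ₁ Λ₂ (X p) (Y p) (Z p) ∂lam =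
      ∫⁻ t in Icc a b, g t * sliceAction Λ₁ Λ₂ lam X Y Z t := by
  rw [lintegral_slice hac (F := fun p => g p.1 * costDensity Λ₁ Λ₂ (X p) (Y p) (Z p))
    ((hg.comp measurable_fst).mul h.measurable_cost),
    setLIntegral_eq_of_support_subset]
  · refine lintegral_congr fun t => ?_
    dsimp only
    rw [lintegral_const_mul _ (h.measurable_cost_slice t), sliceAction,
      mul_left_comm]
  · intro t ht
    by_contra h'
    exact ht (by simp [h.sliceAction_eq_zero h'])

lemma action_eq_lintegral_slice (h : μ.IsCurveDensity Ω a b lam X Y Z)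
    (hac : lam.fst ≪ volume) :
    action Λ₁ Λ₂ μ = ∫⁻ t in Icc a b, sliceAction Λ₁ Λ₂ lam X Y Z t := by
  have := h.lintegral_mul_cost (Λ₁ := Λ₁) (Λ₂ := Λ₂) hac (measurable_const (a := 1))
  simpa [h.toHasDensity.action_eq] using this

/-- The slices of a curve. -/
def slice (h : μ.IsCurveDensity Ω a b lam X Y Z) (t : ℝ) : Triple (Space d) n k :=
  Triple.ofDensity (lam.condKernel t) (sliceDensity lam X t) (sliceDensity lam Y t)
    (sliceDensity lam Z t) fun _ => (h.symm _).smul _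

lemma isDisintegration_slice (h : μ.IsCurveDensity Ω a b lam X Y Z) (hac : lam.fst ≪ volume) :
    IsDisintegration Ω a b μ h.slice := by
  refine ⟨fun t _ => ⟨?_, ?_, ?_⟩, disintegrates_slice hac h.G h.X_off,
    disintegrates_slice hac h.q h.Y_off, disintegrates_slice hac h.R h.Z_off⟩
  · exact ofDensity_carriedBy fun x hx => by
      simp [sliceDensity, h.X_off (t, x) fun hp => hx hp.2]
  · exact ofDensity_carriedBy fun x hx => by
      simp [sliceDensity, h.Y_off (t, x) fun hp => hx hp.2]
  · exact ofDensity_carriedBy fun x hx => by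
      simp [sliceDensity, h.Z_off (t, x) fun hp => hx hp.2]

/-- By uniqueness it suffices to treat `h.slice`, where homogeneity pulls the time density out of
the cost. -/
lemma ae_action_eq (h : μ.IsCurveDensity Ω a b lam X Y Z) (hac : lam.fst ≪ volume)
    {μt : ℝ → Triple (Space d) n k} (ht : IsDisintegration Ω a b μ μt) :
    ∀ᵐ t ∂(volume.restrict (Icc a b)),
      action Λ₁ Λ₂ (μt t) = sliceAction Λ₁ Λ₂ lam X Y Z t := by
  have hs := h.isDisintegration_slice hac
  filter_upwards [ht.2.1.ae_unique hs.2.1, ht.2.2.1.ae_unique hs.2.2.1,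
    ht.2.2.2.ae_unique hs.2.2.2, ae_restrict_of_ae (ae_hasDensity_slice hac h.G),
    ae_restrict_of_ae (ae_hasDensity_slice hac h.q),
    ae_restrict_of_ae (ae_hasDensity_slice hac h.R),
    ae_restrict_of_ae (Measure.rnDeriv_lt_top lam.fst volume)] with t e1 e2 e3 d1 d2 d3 hfin
  have hd : (h.slice t).HasDensity (lam.condKernel t) (sliceDensity lam X t)
    (sliceDensity lam Y t) (sliceDensity lam Z t) := ⟨d1, d2, d3⟩
  rw [Triple.ext' e1 e2 e3, hd.action_eq, sliceAction]
  simp only [sliceDensity, costDensity_smul ENNReal.toReal_nonneg, ENNReal.ofReal_toReal hfin.ne]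
  rw [lintegral_const_mul _ (h.measurable_cost_slice t)]

end Triple.IsCurveDensity

end Slice

/-! ### Test functions -/

section Test

variable {d n k : ℕ}

/-- `∂ₜ Φ`. -/
def timeDeriv (Φ : ℝ × Space d → Mat n n) (p : ℝ × Space d) : Mat n n :=
  Matrix.of fun i j => deriv (fun t => Φ (t, p.2) i j) p.1

/-- `𝖣* Φ`, where `𝖣*` acts on the space variable. -/
def spaceDeriv (D : DiffOp d n k) (Φ : ℝ × Space d → Mat n n) (p : ℝ × Space d) : Mat n k :=
  D.apply (fun x => Φ (p.1, x)) p.2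

lemma hasDerivAt_time {f : ℝ × Space d → ℝ} (hf : ContDiff ℝ 1 f) (t : ℝ) (x : Space d) :
    HasDerivAt (fun t => f (t, x)) (fderiv ℝ f (t, x) (1, 0)) t := by
  have h1 : HasFDerivAt f (fderiv ℝ f (t, x)) (t, x) :=
    (hf.differentiable (by norm_num) _).hasFDerivAt
  have h2 : HasDerivAt (fun t : ℝ => (t, x)) ((1 : ℝ), (0 : Space d)) t :=
    (hasDerivAt_id t).prodMk (hasDerivAt_const t x)
  exact h1.comp_hasDerivAt t h2

lemma continuous_timeDeriv {Φ : ℝ × Space d → Mat n n} (hΦ : IsTestFunction Φ) (i j : Fin n) :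
    Continuous fun p => timeDeriv Φ p i j := by
  have : (fun p => timeDeriv Φ p i j) = fun p => fderiv ℝ (fun p => Φ p i j) p (1, 0) := by
    ext p
    exact (hasDerivAt_time (hΦ.2 i j) p.1 p.2).deriv
  rw [this]
  exact ((hΦ.2 i j).continuous_fderiv (by norm_num)).clm_apply continuous_const

lemma continuous_linearMap_entry {p q r s : ℕ} {α : Type*} [TopologicalSpace α]
    (L : Mat p q →ₗ[ℝ] Mat r s) {W : α → Mat p q} (hW : ∀ i j, Continuous fun x => W x i j)
    (i : Fin r) (j : Fin s) : Continuous fun x => L (W x) i j := by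
  have h : ∀ A : Mat p q, L A i j = ∑ i', ∑ j', A i' j' * L (Matrix.single i' j' 1) i j := by
    intro A
    conv_lhs => rw [Matrix.matrix_eq_sum_single A]
    simp only [map_sum, Matrix.sum_apply]
    refine Finset.sum_congr rfl fun i' _ => Finset.sum_congr rfl fun j' _ => ?_
    have : Matrix.single i' j' (A i' j') = A i' j' • Matrix.single i' j' (1 : ℝ) := by
      simp [Matrix.smul_single]
    rw [this, map_smul]
    rfl
  have h' : (fun x => L (W x) i j) =
    fun x => ∑ i', ∑ j', W x i' j' * L (Matrix.single i' j' 1) i j := funext fun x => h (W x)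
  rw [h']
  exact continuous_finsetSum _ fun i' _ => continuous_finsetSum _ fun j' _ =>
    (hW i' j').mul continuous_const

lemma continuous_spaceDeriv (D : DiffOp d n k) {Φ : ℝ × Space d → Mat n n}
    (hΦ : IsTestFunction Φ) (i : Fin n) (j : Fin k) :
    Continuous fun p => spaceDeriv D Φ p i j := by
  have hd : ∀ (l : Fin d) (r s : Fin n), Continuous fun p : ℝ × Space d =>
      (Matrix.of fun r s => fderiv ℝ (fun y => Φ (p.1, y) r s) p.2
        (EuclideanSpace.single l 1) : Mat n n) r s := by
    intro l r s
    have : (fun p : ℝ × Space d => fderiv ℝ (fun y => Φ (p.1, y) r s) p.2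
        (EuclideanSpace.single l (1 : ℝ))) =
        fun p => fderiv ℝ (fun p => Φ p r s) p (0, EuclideanSpace.single l 1) := by
      ext p
      have h1 : HasFDerivAt (fun p => Φ p r s) (fderiv ℝ (fun p => Φ p r s) (p.1, p.2))
        (p.1, p.2) := ((hΦ.2 r s).differentiable (by norm_num) _).hasFDerivAt
      have h2 : HasFDerivAt (fun y : Space d => (p.1, y)) (ContinuousLinearMap.inr ℝ ℝ (Space d))
        p.2 := hasFDerivAt_prodMk_right p.1 p.2
      have h3 : HasFDerivAt (fun y => Φ (p.1, y) r s)
        ((fderiv ℝ (fun p => Φ p r s) p).comp (ContinuousLinearMap.inr ℝ ℝ (Space d))) p.2 :=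
        h1.comp p.2 h2
      rw [h3.fderiv]
      simp
    simp only [Matrix.of_apply]
    rw [this]
    exact ((hΦ.2 r s).continuous_fderiv (by norm_num)).clm_apply continuous_const
  simp only [spaceDeriv, DiffOp.apply, Matrix.add_apply, Matrix.sum_apply]
  exact (continuous_linearMap_entry D.zeroth (fun i j => (hΦ.2 i j).continuous) i j).add
    (continuous_finsetSum _ fun l _ => continuous_linearMap_entry (D.first l) (hd l) i j)

lemma continuous_entry {Φ : ℝ × Space d → Mat n n} (hΦ : IsTestFunction Φ) (i j : Fin n) :
    Continuous fun p => Φ p i j := (hΦ.2 i j).continuous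

/-- A continuous function is integrable against an integrable density with compact support. -/
lemma integrable_mul_of_eq_zero_off {α : Type*} [TopologicalSpace α] [MeasurableSpace α]
    [OpensMeasurableSpace α] {S : Set α} (hS : IsCompact S) {lam : Measure α} {f w : α → ℝ}
    (hf : Continuous f) (hw : Integrable w lam) (h0 : ∀ᵐ x ∂lam, x ∉ S → w x = 0) :
    Integrable (fun x => f x * w x) lam := by
  obtain ⟨M, hM⟩ := hS.exists_bound_of_continuousOn hf.continuousOn
  refine Integrable.mono' (hw.norm.const_mul M)
    (hf.aestronglyMeasurable.mul hw.aestronglyMeasurable) ?_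
  filter_upwards [h0] with x hx
  by_cases hxS : x ∈ S
  · rw [norm_mul]
    exact mul_le_mul_of_nonneg_right (hM x hxS) (norm_nonneg _)
  · simp [hx hxS]

lemma pairing_smul {α : Type*} [MeasurableSpace α] {p q : ℕ} (c : ℝ) (Φ : α → Mat p q)
    (ν : VectorMeasure α (Mat p q)) : pairing (fun x => c • Φ x) ν = c * pairing Φ ν := by
  simp only [pairing, Matrix.smul_apply, Finset.mul_sum]
  refine Finset.sum_congr rfl fun i _ => Finset.sum_congr rfl fun j _ => ?_
  rw [VectorMeasure.integral_fun_smul]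
  rfl

/-- On constant functions `𝖣*` reduces to its zeroth coefficient, which is linear. -/
lemma apply_const_smul_one {D : DiffOp d n k} (hD : ∀ x, D.apply (fun _ => 1) x = 0) (c : ℝ)
    (x : Space d) : D.apply (fun _ => c • 1) x = 0 := by
  have h0 : ∀ A : Mat n n, D.apply (fun _ => A) x = D.zeroth A := by
    intro A
    have : (Matrix.of fun _ _ => 0 : Mat n n) = 0 := rfl
    simp [DiffOp.apply, this]
  have := hD x
  rw [h0] at this ⊢
  rw [map_smul, this, smul_zero]

end Test

/-! ### The time marginal -/

/-- Indicators of closed sets are limits of bounded continuous functions; inner regularity by closed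
sets extends the inequality to Borel sets. -/
lemma measure_le_of_forall_lintegral_le {m v : Measure ℝ} [IsFiniteMeasure m] [IsFiniteMeasure v]
    (h : ∀ f : BoundedContinuousFunction ℝ NNReal, ∫⁻ t, f t ∂m ≤ ∫⁻ t, f t ∂v) : m ≤ v := by
  have hF : ∀ F : Set ℝ, IsClosed F → m F ≤ v F := fun F hF =>
    le_of_tendsto_of_tendsto' (HasOuterApproxClosed.tendsto_lintegral_apprSeq hF m)
      (HasOuterApproxClosed.tendsto_lintegral_apprSeq hF v) fun n => h _
  refine Measure.le_iff.2 fun A hA => ?_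
  rw [hA.measure_eq_iSup_isClosed_of_ne_top (measure_ne_top _ _)]
  exact iSup₂_le fun F hFA => iSup_le fun hFc => (hF F hFc).trans (measure_mono hFA)

section Marginal

variable {d n k : ℕ} {Ω : Set (Space d)} {a b : ℝ} {D : DiffOp d n k}
  {Ga Gb : VectorMeasure (Space d) (Mat n n)} {μ : Triple (ℝ × Space d) n k}
  {lam : Measure (ℝ × Space d)}
  {X : ℝ × Space d → Mat n n} {Y : ℝ × Space d → Mat n k} {Z : ℝ × Space d → Mat n n}

lemma lintegral_map_fst_withDensity {w : ℝ × Space d → ℝ≥0∞} (hw : Measurable w) {g : ℝ → ℝ≥0∞}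
    (hg : Measurable g) :
    ∫⁻ t, g t ∂((lam.withDensity w).map Prod.fst) = ∫⁻ p, w p * g p.1 ∂lam := by
  rw [lintegral_map hg measurable_fst]
  exact lintegral_withDensity_eq_lintegral_mul _ hw (hg.comp measurable_fst)

lemma isCompact_timeSpace (hΩ : IsCompact Ω) : IsCompact (timeSpace a b Ω) :=
  isCompact_Icc.prod hΩ

/-- The continuity equation in terms of the densities. -/
lemma Triple.IsCurveDensity.continuity_eq (hΩ : IsCompact Ω)
    (h : μ.IsCurveDensity Ω a b lam X Y Z) (hμ : μ ∈ CE D Ω a b Ga Gb)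
    {Φ : ℝ × Space d → Mat n n} (hΦ : IsTestFunction Φ) :
    (∑ i, ∑ j, ∫ p, timeDeriv Φ p i j * X p i j ∂lam)
      + (∑ i, ∑ j, ∫ p, spaceDeriv D Φ p i j * Y p i j ∂lam)
      + (∑ i, ∑ j, ∫ p, Φ p i j * Z p i j ∂lam)
      = pairing (fun x => Φ (b, x)) Gb - pairing (fun x => Φ (a, x)) Ga := by
  have hS : IsCompact (timeSpace a b Ω) := isCompact_timeSpace hΩ
  have key : ∀ {p q : ℕ} {ν : VectorMeasure (ℝ × Space d) (Mat p q)} {W Ψ : ℝ × Space d → Mat p q},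
      WassersteinBures.HasDensity ν lam W → (∀ p, p ∉ timeSpace a b Ω → W p = 0) →
      (∀ i j, Continuous fun p => Ψ p i j) →
      pairing Ψ ν = ∑ i, ∑ j, ∫ p, Ψ p i j * W p i j ∂lam := by
    intro p q ν W Ψ hW h0 hΨ
    exact hW.pairing_eq (fun i j => (hΨ i j).measurable) fun i j =>
      integrable_mul_of_eq_zero_off hS (hΨ i j) (hW.int i j)
        (ae_of_all _ fun x hx => by rw [h0 x hx]; rfl)
  rw [← hμ.2 Φ hΦ, ← key h.G h.X_off (continuous_timeDeriv hΦ),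
    ← key h.q h.Y_off (continuous_spaceDeriv D hΦ), ← key h.R h.Z_off (continuous_entry hΦ)]
  rfl

/-- The time marginal of `G` has a bounded density. -/
lemma Triple.IsCurveDensity.exists_marginal_bound [IsFiniteMeasure lam] (hab : a < b)
    (hΩ : IsCompact Ω) (hD : ∀ x, D.apply (fun _ => 1) x = 0)
    (h : μ.IsCurveDensity Ω a b lam X Y Z) (hμ : μ ∈ CE D Ω a b Ga Gb)
    (hX : ∀ᵐ p ∂lam, 0 ≤ (X p).trace) :
    ∃ C : ℝ, 0 ≤ C ∧ (lam.withDensity fun p => ENNReal.ofReal (X p).trace).map Prod.fst ≤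
      ENNReal.ofReal C • volume.restrict (Icc a b) := by
  have htrm : Measurable fun p => (X p).trace := by
    simp only [Matrix.trace, Matrix.diag_apply]
    exact Finset.measurable_fun_sum _ fun i _ => h.G.meas i i
  have htri : Integrable (fun p => (X p).trace) lam := by
    simp only [Matrix.trace, Matrix.diag_apply]
    exact integrable_finsetSum _ fun i _ => h.G.int i i
  have hZi : Integrable (fun p => (Z p).trace) lam := by
    simp only [Matrix.trace, Matrix.diag_apply]
    exact integrable_finsetSum _ fun i _ => h.R.int i i
  set κ : ℝ := pairing (fun _ => 1) Gb with hκ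
  -- With `φ' = f` and `φ(a) = 0`, the equation tested with `φ(t) I` reads `∫ f tr X = φ(b) κ - ∫ φ
  -- tr Z`. Since `0 ≤ φ ≤ φ(b) = ∫ f`, the right side is at most `C ∫ f`.
  set C : ℝ := |κ| + ∫ p, |(Z p).trace| ∂lam with hC
  have hC0 : 0 ≤ C := add_nonneg (abs_nonneg _) (integral_nonneg fun _ => abs_nonneg _)
  refine ⟨C, hC0, ?_⟩
  have : IsFiniteMeasure (lam.withDensity fun p => ENNReal.ofReal (X p).trace) :=
    isFiniteMeasure_withDensity_ofReal htri.2
  have : IsFiniteMeasure (ENNReal.ofReal C • (volume.restrict (Icc a b) : Measure ℝ)) :=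
    ⟨by simpa using ENNReal.mul_lt_top ENNReal.ofReal_lt_top ENNReal.ofReal_lt_top⟩
  refine measure_le_of_forall_lintegral_le fun f => ?_
  set φ : ℝ → ℝ := fun t => ∫ s in a..t, (f s : ℝ) with hφ
  have hfc : Continuous fun s => (f s : ℝ) := by fun_prop
  have hder : ∀ t, HasDerivAt φ (f t) t := fun t =>
    intervalIntegral.integral_hasDerivAt_right (hfc.intervalIntegrable _ _)
      (hfc.stronglyMeasurableAtFilter _ _) hfc.continuousAt
  have hφ1 : ContDiff ℝ 1 φ := contDiff_one_iff_deriv.2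
    ⟨fun t => (hder t).differentiableAt, by
      have : deriv φ = fun t => (f t : ℝ) := funext fun t => (hder t).deriv
      rw [this]; exact hfc⟩
  have hφ0 : ∀ t ∈ Icc a b, 0 ≤ φ t ∧ φ t ≤ φ b := by
    intro t ht
    refine ⟨intervalIntegral.integral_nonneg ht.1 fun s _ => (f s).2, ?_⟩
    have : φ t + ∫ s in t..b, (f s : ℝ) = φ b :=
      intervalIntegral.integral_add_adjacent_intervals (hfc.intervalIntegrable _ _)
        (hfc.intervalIntegrable _ _)
    have h2 : 0 ≤ ∫ s in t..b, (f s : ℝ) :=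
      intervalIntegral.integral_nonneg ht.2 fun s _ => (f s).2
    linarith
  have hφb := (hφ0 b ⟨hab.le, le_rfl⟩).1
  set Φ : ℝ × Space d → Mat n n := fun p => φ p.1 • 1 with hΦdef
  have hΦ : IsTestFunction Φ := by
    refine ⟨fun p => ?_, fun i j => ?_⟩
    · simp [hΦdef, Matrix.IsSymm]
    · simp only [hΦdef, Matrix.smul_apply, smul_eq_mul]
      exact (hφ1.comp contDiff_fst).mul contDiff_const
  have hce := h.continuity_eq hΩ hμ hΦ
  have e1 : ∀ p, timeDeriv Φ p = (f p.1 : ℝ) • (1 : Mat n n) := by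
    intro p
    ext i j
    simp only [timeDeriv, Matrix.of_apply, hΦdef, Matrix.smul_apply, smul_eq_mul]
    exact ((hder p.1).mul_const _).deriv
  have e2 : ∀ p, spaceDeriv D Φ p = 0 := fun p => apply_const_smul_one hD (φ p.1) p.2
  have e3 : pairing (fun x => Φ (b, x)) Gb = φ b * κ := pairing_smul (φ b) (fun _ => 1) Gb
  have e4 : pairing (fun x => Φ (a, x)) Ga = 0 := by
    have : pairing (fun x => Φ (a, x)) Ga = φ a * pairing (fun _ => 1) Ga :=
      pairing_smul (φ a) (fun _ => 1) Ga
    rw [this]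
    simp [hφ]
  have hdiag : ∀ (c : ℝ → ℝ) (W : ℝ × Space d → Mat n n), Continuous c →
      (∀ i j, Integrable (fun p => W p i j) lam) → (∀ p, p ∉ timeSpace a b Ω → W p = 0) →
      Integrable (fun p => c p.1 * (W p).trace) lam ∧
      ∑ i, ∑ j, ∫ p, (c p.1 • (1 : Mat n n)) i j * W p i j ∂lam =
        ∫ p, c p.1 * (W p).trace ∂lam := by
    intro c W hc hWi hW0
    have hi : ∀ i, Integrable (fun p => c p.1 * W p i i) lam := fun i =>
      integrable_mul_of_eq_zero_off (isCompact_timeSpace hΩ) (hc.comp continuous_fst) (hWi i i)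
        (ae_of_all _ fun x hx => by rw [hW0 x hx]; rfl)
    simp only [Matrix.trace, Matrix.diag_apply, Finset.mul_sum]
    refine ⟨integrable_finsetSum _ fun i _ => hi i, ?_⟩
    rw [integral_finsetSum _ fun i _ => hi i]
    refine Finset.sum_congr rfl fun i _ => ?_
    rw [Finset.sum_eq_single i]
    · simp
    · intro j _ hij
      simp [Matrix.one_apply_ne' hij]
    · simp
  obtain ⟨i1, s1⟩ := hdiag (fun t => (f t : ℝ)) X hfc h.G.int h.X_off
  obtain ⟨i2, s2⟩ := hdiag φ Z hφ1.continuous h.R.int h.Z_off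
  have e5 : ∑ i, ∑ j, ∫ p, Φ p i j * Z p i j ∂lam = ∫ p, φ p.1 * (Z p).trace ∂lam := s2
  have e6 : ∑ i, ∑ j, ∫ p, spaceDeriv D Φ p i j * Y p i j ∂lam = 0 := by simp [e2]
  rw [e3, e4, e5, e6, add_zero, sub_zero] at hce
  simp only [e1] at hce
  rw [s1] at hce
  have hle : ∫ p, (f p.1 : ℝ) * (X p).trace ∂lam ≤ C * φ b := by
    have hb : -(φ b * ∫ p, |(Z p).trace| ∂lam) ≤ ∫ p, φ p.1 * (Z p).trace ∂lam := by
      rw [← integral_const_mul, ← integral_neg]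
      refine integral_mono (hZi.abs.const_mul _).neg i2 fun p => ?_
      by_cases hp : p ∈ timeSpace a b Ω
      · have h1 := hφ0 p.1 hp.1
        have h2 : |φ p.1 * (Z p).trace| ≤ φ b * |(Z p).trace| := by
          rw [abs_mul, abs_of_nonneg h1.1]
          exact mul_le_mul_of_nonneg_right h1.2 (abs_nonneg _)
        exact (abs_le.1 h2).1
      · simp [h.Z_off p hp]
    have h3 : φ b * κ ≤ φ b * |κ| := mul_le_mul_of_nonneg_left (le_abs_self _) hφb
    rw [hC]
    linarith
  have hL : ∫⁻ t, f t ∂((lam.withDensity fun p => ENNReal.ofReal (X p).trace).map Prod.fst) =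
      ENNReal.ofReal (∫ p, (f p.1 : ℝ) * (X p).trace ∂lam) := by
    have hfm : Measurable fun t => (f t : ℝ≥0∞) := by fun_prop
    rw [lintegral_map_fst_withDensity htrm.ennreal_ofReal hfm,
      ofReal_integral_eq_lintegral_ofReal i1]
    · refine lintegral_congr fun p => ?_
      rw [ENNReal.ofReal_mul (NNReal.coe_nonneg _), mul_comm]
      simp
    · filter_upwards [hX] with p hp
      exact mul_nonneg (f p.1).2 hp
  have hR : ∫⁻ t, f t ∂(ENNReal.ofReal C • (volume.restrict (Icc a b) : Measure ℝ)) =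
      ENNReal.ofReal (C * φ b) := by
    rw [lintegral_smul_measure, ENNReal.ofReal_mul hC0, hφ]
    dsimp only
    rw [intervalIntegral.integral_of_le hab.le, ← integral_Icc_eq_integral_Ioc,
      ofReal_integral_eq_lintegral_ofReal hfc.integrableOn_Icc (ae_of_all _ fun t => (f t).2)]
    simp
  rw [hL, hR]
  exact ENNReal.ofReal_le_ofReal hle

/-- A curve whose cost is finite almost everywhere has a bounded time marginal. -/
lemma Triple.IsCurveDensity.exists_lintegral_bound [IsFiniteMeasure lam] (hab : a < b)
    {Λ₁ : Mat k k} {Λ₂ : Mat n n}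
    (hΩ : IsCompact Ω) (hD : ∀ x, D.apply (fun _ => 1) x = 0)
    (h : μ.IsCurveDensity Ω a b lam X Y Z) (hμ : μ ∈ CE D Ω a b Ga Gb)
    (hJ : ∀ᵐ p ∂lam, costDensity Λ₁ Λ₂ (X p) (Y p) (Z p) < ∞) :
    ∃ C : ℝ, 0 ≤ C ∧ ∀ (g : ℝ → ℝ≥0∞), Measurable g → ∀ i j,
      ∫⁻ p, g p.1 * ‖X p i j‖ₑ ∂lam ≤ ENNReal.ofReal C * ∫⁻ t in Icc a b, g t := by
  obtain ⟨C, hC0, hC⟩ := h.exists_marginal_bound hab hΩ hD hμ (by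
    filter_upwards [hJ] with p hp
    exact Finset.sum_nonneg fun i _ => diag_nonneg_of_costDensity_lt_top hp i)
  refine ⟨C, hC0, fun g hg i j => ?_⟩
  have htrm : Measurable fun p => (X p).trace := by
    simp only [Matrix.trace, Matrix.diag_apply]
    exact Finset.measurable_fun_sum _ fun i _ => h.G.meas i i
  have h1 := lintegral_mono' hC (le_refl g)
  rw [lintegral_smul_measure, lintegral_map_fst_withDensity htrm.ennreal_ofReal hg] at h1
  refine le_trans (lintegral_mono_ae ?_) h1
  filter_upwards [hJ] with p hp
  rw [mul_comm, Real.enorm_eq_ofReal_abs]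
  gcongr
  exact abs_le_trace_of_costDensity_lt_top (h.symm p) hp i j

/-- A curve whose cost is finite almost everywhere can be disintegrated in time. -/
lemma Triple.IsCurveDensity.ac_of_cost_lt_top [IsFiniteMeasure lam] (hab : a < b)
    {Λ₁ : Mat k k} {Λ₂ : Mat n n} (hΛ₁ : Λ₁.PosSemidef) (hΛ₂ : Λ₂.PosSemidef)
    (hΩ : IsCompact Ω) (hD : ∀ x, D.apply (fun _ => 1) x = 0)
    (h : μ.IsCurveDensity Ω a b lam X Y Z) (hμ : μ ∈ CE D Ω a b Ga Gb)
    (hJ : ∀ᵐ p ∂lam, costDensity Λ₁ Λ₂ (X p) (Y p) (Z p) < ∞) :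
    lam.fst ≪ volume := by
  obtain ⟨C, hC0, hC⟩ := h.exists_lintegral_bound hab hΩ hD hμ hJ
  refine Measure.AbsolutelyContinuous.mk fun N hN h0 => ?_
  have h1 : ∀ᵐ p ∂lam, ∀ i j, p.1 ∈ N → X p i j = 0 := by
    refine ae_all_iff.2 fun i => ae_all_iff.2 fun j => ?_
    -- The marginal bound with `g` the indicator of the null set `N`.
    have hz : ∫⁻ p, N.indicator 1 p.1 * ‖X p i j‖ₑ ∂lam = 0 := by
      refine le_antisymm ((hC _ (measurable_one.indicator hN) i j).trans (le_of_eq ?_)) zero_le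
      rw [lintegral_indicator_one hN, Measure.restrict_apply hN,
        measure_mono_null inter_subset_left h0, mul_zero]
    have hm : Measurable fun p : ℝ × Space d => N.indicator (1 : ℝ → ℝ≥0∞) p.1 * ‖X p i j‖ₑ :=
      ((measurable_one.indicator hN).comp measurable_fst).mul (h.G.meas i j).enorm
    filter_upwards [(lintegral_eq_zero_iff hm).1 hz] with p hp hpN
    simpa [hpN] using hp
  rw [Measure.fst_apply hN, measure_eq_zero_iff_ae_notMem]
  filter_upwards [h1, hJ, h.ae_ne_zero] with p hp hpJ hne hpN
  have hX0 : X p = 0 := by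
    ext i j
    exact hp i j hpN
  rw [hX0] at hpJ
  exact hne ⟨hX0, eq_zero_of_costDensity_lt_top hΛ₁ hΛ₂ hpJ⟩

end Marginal

/-! ### Change of time -/

section TimeChange

variable {d n k : ℕ} {Ω : Set (Space d)} {a b : ℝ} {D : DiffOp d n k}
  {Ga Gb : VectorMeasure (Space d) (Mat n n)} {μ : Triple (ℝ × Space d) n k}
  {lam : Measure (ℝ × Space d)}
  {X : ℝ × Space d → Mat n n} {Y : ℝ × Space d → Mat n k} {Z : ℝ × Space d → Mat n n}

lemma tendsto_integral_timeChange (hΩ : IsCompact Ω) {F w : ℝ × Space d → ℝ} (hF : Continuous F)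
    (hw : Integrable w lam) (h0 : ∀ p, p ∉ timeSpace a b Ω → w p = 0) {s : ℝ → ℝ}
    {sn : ℕ → ℝ → ℝ} (hsn : ∀ m, Continuous (sn m)) {R : ℝ} (hR : ∀ m, ∀ t ∈ Icc a b, |sn m t| ≤ R)
    (hlim : ∀ t ∈ Icc a b, Tendsto (fun m => sn m t) atTop (𝓝 (s t))) :
    Tendsto (fun m => ∫ p, F (sn m p.1, p.2) * w p ∂lam) atTop
      (𝓝 (∫ p, F (s p.1, p.2) * w p ∂lam)) := by
  obtain ⟨M, hM⟩ := (isCompact_timeSpace (a := -R) (b := R) hΩ).exists_bound_of_continuousOn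
    hF.continuousOn
  refine tendsto_integral_of_dominated_convergence (fun p => M * ‖w p‖) (fun m => ?_)
    (hw.norm.const_mul M) (fun m => ae_of_all _ fun p => ?_) (ae_of_all _ fun p => ?_)
  · have : Continuous fun p : ℝ × Space d => F (sn m p.1, p.2) := by
      have := hsn m
      fun_prop
    exact this.aestronglyMeasurable.mul hw.aestronglyMeasurable
  · by_cases hp : p ∈ timeSpace a b Ω
    · rw [norm_mul]
      exact mul_le_mul_of_nonneg_right (hM _ ⟨abs_le.1 (hR m p.1 hp.1), hp.2⟩) (norm_nonneg _)
    · simp [h0 p hp]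
  · by_cases hp : p ∈ timeSpace a b Ω
    · refine Tendsto.mul_const _ ?_
      have h1 : Tendsto (fun m => (sn m p.1, p.2)) atTop (𝓝 (s p.1, p.2)) :=
        (hlim p.1 hp.1).prodMk_nhds tendsto_const_nhds
      exact (hF.tendsto _).comp h1
    · simp [h0 p hp]

/-- Needed for the boundary term at `b`: the approximate time changes agree with `s` at `a`, but
only converge to it at `b`. -/
lemma continuous_pairing_slice (hΩ : IsCompact Ω) {ν : VectorMeasure (Space d) (Mat n n)}
    (hν : CarriedBy ν Ω) {Φ : ℝ × Space d → Mat n n} (hΦ : IsTestFunction Φ) :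
    Continuous fun t => pairing (fun x => Φ (t, x)) ν := by
  have hd := hasDensity_density ν (lam := entryVariation ν) Measure.AbsolutelyContinuous.rfl
  have h0 := hd.ae_eq_zero_of_carriedBy hΩ.measurableSet hν
  set w := density ν (entryVariation ν) with hw
  have h0' : ∀ i j, ∀ᵐ x ∂entryVariation ν, x ∉ Ω → w x i j = 0 := fun i j => by
    filter_upwards [h0] with x hx hxΩ
    rw [hx hxΩ]
    rfl
  have hc : ∀ i j, Continuous fun p => Φ p i j := continuous_entry hΦ
  have hcx : ∀ t i j, Continuous fun x => Φ (t, x) i j := fun t i j =>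
    (hc i j).comp (Continuous.prodMk_right t)
  have e : (fun t => pairing (fun x => Φ (t, x)) ν) = fun t =>
      ∑ i, ∑ j, ∫ x, Φ (t, x) i j * w x i j ∂entryVariation ν := by
    ext t
    exact hd.pairing_eq (fun i j => (hcx t i j).measurable) fun i j =>
      integrable_mul_of_eq_zero_off hΩ (hcx t i j) (hd.int i j) (h0' i j)
  rw [e]
  refine continuous_finsetSum _ fun i _ => continuous_finsetSum _ fun j _ => ?_
  refine continuous_iff_continuousAt.2 fun τ => ?_
  obtain ⟨M, hM⟩ := (isCompact_timeSpace (a := τ - 1) (b := τ + 1) hΩ).exists_bound_of_continuousOn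
    (hc i j).continuousOn
  refine continuousAt_of_dominated (bound := fun x => M * ‖w x i j‖)
    (Eventually.of_forall fun t =>
      (hcx t i j).aestronglyMeasurable.mul (hd.int i j).aestronglyMeasurable) ?_
    ((hd.int i j).norm.const_mul M) (ae_of_all _ fun x => ?_)
  · filter_upwards [Icc_mem_nhds (sub_one_lt τ) (lt_add_one τ)] with t ht
    filter_upwards [h0' i j] with x hx
    by_cases hxΩ : x ∈ Ω
    · rw [norm_mul]
      exact mul_le_mul_of_nonneg_right (hM (t, x) ⟨ht, hxΩ⟩) (norm_nonneg _)
    · simp [hx hxΩ]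
  · exact (((hc i j).comp (Continuous.prodMk_left x)).mul continuous_const).continuousAt

/-- The weak continuity equation holds for the composition of a test function with an absolutely
continuous change of time. -/
lemma Triple.IsCurveDensity.continuity_eq_timeChange [IsFiniteMeasure lam] (hab : a ≤ b)
    (hΩ : IsCompact Ω)
    (h : μ.IsCurveDensity Ω a b lam X Y Z) (hμ : μ ∈ CE D Ω a b Ga Gb) (hGb : WassersteinBures.CarriedBy Gb Ω)
    {C : ℝ} (hC0 : 0 ≤ C) (hC : ∀ (g : ℝ → ℝ≥0∞), Measurable g → ∀ i j,
      ∫⁻ p, g p.1 * ‖X p i j‖ₑ ∂lam ≤ ENNReal.ofReal C * ∫⁻ t in Icc a b, g t)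
    {r s : ℝ → ℝ} (hrm : Measurable r) (hri : IntegrableOn r (Icc a b))
    (hs : ∀ t ∈ Icc a b, s t = s a + ∫ u in a..t, r u)
    {Φ : ℝ × Space d → Mat n n} (hΦ : IsTestFunction Φ) :
    (∀ i j, Integrable (fun p => r p.1 * X p i j) lam) ∧
    (∑ i, ∑ j, ∫ p, timeDeriv Φ (s p.1, p.2) i j * (r p.1 * X p i j) ∂lam)
      + (∑ i, ∑ j, ∫ p, spaceDeriv D Φ (s p.1, p.2) i j * Y p i j ∂lam)
      + (∑ i, ∑ j, ∫ p, Φ (s p.1, p.2) i j * Z p i j ∂lam)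
      = pairing (fun x => Φ (s b, x)) Gb - pairing (fun x => Φ (s a, x)) Ga := by
  -- The marginal bound makes `c(t) X` integrable for `c` merely in `L¹`.
  have hint : ∀ {c : ℝ → ℝ}, Measurable c → IntegrableOn c (Icc a b) → ∀ i j,
      Integrable (fun p => c p.1 * X p i j) lam := by
    intro c hcm hci i j
    refine ⟨((hcm.comp measurable_fst).mul (h.G.meas i j)).aestronglyMeasurable, ?_⟩
    rw [hasFiniteIntegral_def]
    simp only [enorm_mul]
    exact (hC (fun t => ‖c t‖ₑ) hcm.enorm i j).trans_lt
      (ENNReal.mul_lt_top ENNReal.ofReal_lt_top hci.2)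
  refine ⟨hint hrm hri, ?_⟩
  -- Continuous `gₘ → r` in `L¹` have `C¹` primitives, so `Φ(sₘ(t), x)` is a genuine test function,
  -- and `sₘ → s` uniformly on `[a, b]`.
  have hex : ∀ m : ℕ, ∃ g : ℝ → ℝ, Continuous g ∧
      ∫ t in Icc a b, ‖r t - g t‖ ≤ 1 / ((m : ℝ) + 1) := fun m => by
    obtain ⟨g, -, h1, h2, -⟩ := Integrable.exists_hasCompactSupport_integral_sub_le hri
      (Nat.one_div_pos_of_nat (α := ℝ) (n := m))
    exact ⟨g, h2, h1⟩
  choose g hgc hg using hex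
  set sn : ℕ → ℝ → ℝ := fun m t => s a + ∫ u in a..t, g m u with hsn
  have hder : ∀ m t, HasDerivAt (sn m) (g m t) t := fun m t =>
    (intervalIntegral.integral_hasDerivAt_right ((hgc m).intervalIntegrable _ _)
      ((hgc m).stronglyMeasurableAtFilter _ _) (hgc m).continuousAt).const_add _
  have hsn1 : ∀ m, ContDiff ℝ 1 (sn m) := fun m => contDiff_one_iff_deriv.2
    ⟨fun t => (hder m t).differentiableAt, by
      rw [show deriv (sn m) = g m from funext fun t => (hder m t).deriv]
      exact hgc m⟩
  have hgi : ∀ m, IntegrableOn (g m) (Icc a b) := fun m => (hgc m).integrableOn_Icc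
  have hclose : ∀ m, ∀ t ∈ Icc a b, |s t - sn m t| ≤ 1 / ((m : ℝ) + 1) := by
    intro m t ht
    have hsub : Ioc a t ⊆ Icc a b := fun u hu => ⟨hu.1.le, hu.2.trans ht.2⟩
    have e : s t - sn m t = ∫ u in Ioc a t, (r u - g m u) := by
      rw [hs t ht, hsn]
      dsimp only
      rw [add_sub_add_left_eq_sub, intervalIntegral.integral_of_le ht.1,
        intervalIntegral.integral_of_le ht.1,
        integral_sub (hri.mono_set hsub) ((hgi m).mono_set hsub)]
    rw [e]
    refine (norm_integral_le_integral_norm _).trans ((setIntegral_mono_set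
      (hri.sub (hgi m)).norm (ae_of_all _ fun _ => norm_nonneg _) hsub.eventuallyLE).trans (hg m))
  have hlim : ∀ t ∈ Icc a b, Tendsto (fun m => sn m t) atTop (𝓝 (s t)) := by
    intro t ht
    refine tendsto_iff_dist_tendsto_zero.2 (squeeze_zero (fun _ => dist_nonneg) (fun m => ?_)
      tendsto_one_div_add_atTop_nhds_zero_nat)
    rw [dist_comm, Real.dist_eq]
    exact hclose m t ht
  obtain ⟨R, hR⟩ : ∃ R, ∀ m, ∀ t ∈ Icc a b, |sn m t| ≤ R := by
    refine ⟨|s a| + (∫ u in Icc a b, ‖r u‖) + 1, fun m t ht => ?_⟩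
    have hsub : Ioc a t ⊆ Icc a b := fun u hu => ⟨hu.1.le, hu.2.trans ht.2⟩
    have h1 : |s t| ≤ |s a| + ∫ u in Icc a b, ‖r u‖ := by
      rw [hs t ht, intervalIntegral.integral_of_le ht.1]
      refine (abs_add_le _ _).trans (add_le_add le_rfl ?_)
      exact (norm_integral_le_integral_norm _).trans (setIntegral_mono_set
        hri.norm (ae_of_all _ fun _ => norm_nonneg _) hsub.eventuallyLE)
    have h2 : 1 / ((m : ℝ) + 1) ≤ 1 := by
      rw [div_le_one (by positivity)]
      linarith [(Nat.cast_nonneg m : (0 : ℝ) ≤ m)]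
    have h3 : |sn m t| ≤ |s t| + |s t - sn m t| := by
      have := abs_sub_abs_le_abs_sub (sn m t) (s t)
      rw [abs_sub_comm (sn m t)] at this
      linarith
    linarith [hclose m t ht]
  have hsnc : ∀ m, Continuous (sn m) := fun m => (hsn1 m).continuous
  have hΦn : ∀ m, IsTestFunction fun p : ℝ × Space d => Φ (sn m p.1, p.2) := fun m =>
    ⟨fun p => hΦ.1 _, fun i j => (hΦ.2 i j).comp
      (((hsn1 m).comp contDiff_fst).prodMk contDiff_snd)⟩
  have htd : ∀ m p i j, timeDeriv (fun p : ℝ × Space d => Φ (sn m p.1, p.2)) p i j =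
      timeDeriv Φ (sn m p.1, p.2) i j * g m p.1 := by
    intro m p i j
    have h1 := hasDerivAt_time (hΦ.2 i j) (sn m p.1) p.2
    have h2 : HasDerivAt (fun t => Φ (sn m t, p.2) i j) _ p.1 := h1.comp p.1 (hder m p.1)
    simp only [timeDeriv, Matrix.of_apply]
    rw [h2.deriv, h1.deriv]
  have hce := fun m => h.continuity_eq hΩ hμ (hΦn m)
  have hsna : ∀ m, sn m a = s a := fun m => by simp [hsn]
  have t1 : ∀ i j, Tendsto (fun m => ∫ p,
      timeDeriv (fun p : ℝ × Space d => Φ (sn m p.1, p.2)) p i j * X p i j ∂lam) atTop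
      (𝓝 (∫ p, timeDeriv Φ (s p.1, p.2) i j * (r p.1 * X p i j) ∂lam)) := by
    intro i j
    have hFc := continuous_timeDeriv hΦ i j
    obtain ⟨M, hM⟩ := (isCompact_timeSpace (a := -R) (b := R) hΩ).exists_bound_of_continuousOn
      hFc.continuousOn
    have hM0 : 0 ≤ max M 0 := le_max_right _ _
    have hFn : ∀ m, Continuous fun p : ℝ × Space d => timeDeriv Φ (sn m p.1, p.2) i j := fun m =>
      hFc.comp (((hsnc m).comp continuous_fst).prodMk continuous_snd)
    have hX0 : ∀ p, p ∉ timeSpace a b Ω → X p i j = 0 := fun p hp => by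
      rw [h.X_off p hp]
      rfl
    have q1 := tendsto_integral_timeChange hΩ hFc (hint hrm hri i j)
      (fun p hp => by simp [hX0 p hp]) hsnc hR hlim
    -- The error from replacing `gₘ` by `r` is at most `max M 0 * C * ‖gₘ - r‖₁`, again by the
    -- marginal bound.
    have q2 : Tendsto (fun m => ∫ p, timeDeriv Φ (sn m p.1, p.2) i j *
        ((g m p.1 - r p.1) * X p i j) ∂lam) atTop (𝓝 0) := by
      have hlim0 : Tendsto (fun m : ℕ => max M 0 * C * (1 / ((m : ℝ) + 1))) atTop (𝓝 0) := by
        simpa using tendsto_one_div_add_atTop_nhds_zero_nat.const_mul (max M 0 * C)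
      refine squeeze_zero_norm (fun m => ?_) hlim0
      have hb : 0 ≤ max M 0 * C * (1 / ((m : ℝ) + 1)) := by positivity
      rw [← ENNReal.ofReal_le_ofReal_iff hb, ofReal_norm]
      refine (enorm_integral_le_lintegral_enorm _).trans ?_
      have hbound : ∀ p, ‖timeDeriv Φ (sn m p.1, p.2) i j * ((g m p.1 - r p.1) * X p i j)‖ₑ ≤
          ENNReal.ofReal (max M 0) * (‖r p.1 - g m p.1‖ₑ * ‖X p i j‖ₑ) := by
        intro p
        by_cases hp : p ∈ timeSpace a b Ω
        · rw [enorm_mul, enorm_mul, ← enorm_neg (g m p.1 - r p.1), neg_sub]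
          gcongr
          rw [← ofReal_norm]
          exact ENNReal.ofReal_le_ofReal
            ((hM (sn m p.1, p.2) ⟨abs_le.1 (hR m p.1 hp.1), hp.2⟩).trans (le_max_left _ _))
        · simp [hX0 p hp]
      refine (lintegral_mono hbound).trans ?_
      rw [lintegral_const_mul' _ _ ENNReal.ofReal_ne_top, mul_assoc, ENNReal.ofReal_mul hM0,
        ENNReal.ofReal_mul hC0]
      gcongr
      refine (hC (fun t => ‖r t - g m t‖ₑ) (hrm.sub (hgc m).measurable).enorm i j).trans ?_
      gcongr
      have hsub : Integrable (fun t => r t - g m t) (volume.restrict (Icc a b)) :=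
        hri.sub (hgi m)
      rw [← ofReal_integral_norm_eq_lintegral_enorm hsub]
      exact ENNReal.ofReal_le_ofReal (hg m)
    have q3 := q1.add q2
    rw [add_zero] at q3
    refine q3.congr fun m => ?_
    have hoff : ∀ c : ℝ → ℝ, ∀ᵐ p ∂lam, p ∉ timeSpace a b Ω → c p.1 * X p i j = 0 := fun c =>
      ae_of_all _ fun p hp => by simp [hX0 p hp]
    rw [← integral_add (integrable_mul_of_eq_zero_off (isCompact_timeSpace hΩ) (hFn m)
      (hint hrm hri i j) (hoff r)) (integrable_mul_of_eq_zero_off (isCompact_timeSpace hΩ) (hFn m)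
      (hint (c := fun t => g m t - r t) ((hgc m).measurable.sub hrm) ((hgi m).sub hri) i j)
      (hoff fun t => g m t - r t))]
    refine integral_congr_ae (ae_of_all _ fun p => ?_)
    simp only [htd]
    ring
  have t2 : ∀ i j, Tendsto (fun m => ∫ p,
      spaceDeriv D (fun p : ℝ × Space d => Φ (sn m p.1, p.2)) p i j * Y p i j ∂lam) atTop
      (𝓝 (∫ p, spaceDeriv D Φ (s p.1, p.2) i j * Y p i j ∂lam)) := fun i j =>
    tendsto_integral_timeChange hΩ (continuous_spaceDeriv D hΦ i j) (h.q.int i j)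
      (fun p hp => by rw [h.Y_off p hp]; rfl) hsnc hR hlim
  have t3 : ∀ i j, Tendsto (fun m => ∫ p, Φ (sn m p.1, p.2) i j * Z p i j ∂lam) atTop
      (𝓝 (∫ p, Φ (s p.1, p.2) i j * Z p i j ∂lam)) := fun i j =>
    tendsto_integral_timeChange hΩ (continuous_entry hΦ i j) (h.R.int i j)
      (fun p hp => by rw [h.Z_off p hp]; rfl) hsnc hR hlim
  have t4 : Tendsto (fun m => pairing (fun x => Φ (sn m b, x)) Gb) atTop
      (𝓝 (pairing (fun x => Φ (s b, x)) Gb)) :=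
    ((continuous_pairing_slice hΩ hGb hΦ).tendsto (s b)).comp (hlim b ⟨hab, le_rfl⟩)
  have L := ((tendsto_finsetSum Finset.univ fun i _ => tendsto_finsetSum Finset.univ
    fun j _ => t1 i j).add (tendsto_finsetSum Finset.univ fun i _ => tendsto_finsetSum Finset.univ
    fun j _ => t2 i j)).add (tendsto_finsetSum Finset.univ fun i _ =>
    tendsto_finsetSum Finset.univ fun j _ => t3 i j)
  have Rt := t4.sub_const (pairing (fun x => Φ (s a, x)) Ga)
  refine tendsto_nhds_unique L (Rt.congr fun m => ?_)
  rw [hce m]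
  simp only [hsna]

/-- The homeomorphism `t ↦ a' + ∫ₐᵗ r` of the line. -/
lemma exists_homeomorph_primitive {r : ℝ → ℝ} {ε : ℝ} (hε : 0 < ε) (hr : ∀ t, ε ≤ r t)
    (hri : LocallyIntegrable r) (a a' : ℝ) :
    ∃ e : ℝ ≃ₜ ℝ, StrictMono e ∧ ∀ t, e t = a' + ∫ u in a..t, r u := by
  have hii : ∀ t u, IntervalIntegrable r volume t u := fun t u =>
    (hri.integrableOn_isCompact isCompact_uIcc).intervalIntegrable
  set s : ℝ → ℝ := fun t => a' + ∫ u in a..t, r u with hs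
  -- Slope at least `ε` gives both strict monotonicity and divergence at `±∞`, hence surjectivity.
  have hinc : ∀ t u, t ≤ u → ε * (u - t) ≤ s u - s t := by
    intro t u htu
    have e : s u - s t = ∫ v in t..u, r v := by
      rw [hs]
      dsimp only
      rw [add_sub_add_left_eq_sub, intervalIntegral.integral_interval_sub_left (hii _ _) (hii _ _)]
    have h1 : ∫ _ in t..u, ε = ε * (u - t) := by
      rw [intervalIntegral.integral_const, smul_eq_mul, mul_comm]
    rw [e, ← h1]
    exact intervalIntegral.integral_mono_on htu intervalIntegrable_const (hii _ _) fun v _ => hr v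
  have hmono : StrictMono s := fun t u htu => by
    have := hinc t u htu.le
    have : 0 < ε * (u - t) := mul_pos hε (sub_pos.2 htu)
    linarith
  have hcont : Continuous s := continuous_const.add (intervalIntegral.continuous_primitive hii a)
  have htop : Tendsto s atTop atTop := by
    refine tendsto_atTop_mono' _ (f₁ := fun t => s 0 + ε * t) ?_
      (tendsto_atTop_add_const_left _ _ (tendsto_id.const_mul_atTop hε))
    filter_upwards [eventually_ge_atTop 0] with t ht
    have := hinc 0 t ht
    linarith
  have hbot : Tendsto s atBot atBot := by
    refine tendsto_atBot_mono' _ (f₁ := fun t => s 0 + ε * t) ?_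
      (tendsto_atBot_add_const_left _ _ (tendsto_id.const_mul_atBot hε))
    filter_upwards [eventually_le_atBot 0] with t ht
    have := hinc t 0 ht
    linarith
  exact ⟨(hmono.orderIsoOfSurjective s (hcont.surjective htop hbot)).toHomeomorph, hmono,
    fun t => rfl⟩

/-- The time change of a curve, and its action. -/
lemma Triple.IsCurveDensity.exists_timeChange [IsFiniteMeasure lam] {Λ₁ : Mat k k} {Λ₂ : Mat n n}
    (hab : a ≤ b) (hΩ : IsCompact Ω)
    (h : μ.IsCurveDensity Ω a b lam X Y Z) (hμ : μ ∈ CE D Ω a b Ga Gb) (hGb : WassersteinBures.CarriedBy Gb Ω)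
    {C : ℝ} (hC0 : 0 ≤ C) (hC : ∀ (g : ℝ → ℝ≥0∞), Measurable g → ∀ i j,
      ∫⁻ p, g p.1 * ‖X p i j‖ₑ ∂lam ≤ ENNReal.ofReal C * ∫⁻ t in Icc a b, g t)
    {r : ℝ → ℝ} (hrm : Measurable r) {ε : ℝ} (hε : 0 < ε) (hr : ∀ t, ε ≤ r t)
    (hri : LocallyIntegrable r) {a' b' : ℝ} (hb' : b' = a' + ∫ t in a..b, r t) :
    ∃ ν ∈ CE D Ω a' b' Ga Gb, action Λ₁ Λ₂ ν =
      ∫⁻ p, ENNReal.ofReal (r p.1)⁻¹ * costDensity Λ₁ Λ₂ (X p) (Y p) (Z p) ∂lam := by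
  obtain ⟨e, hmono, he⟩ := exists_homeomorph_primitive hε hr hri a a'
  have hea : e a = a' := by simp [he]
  have heb : e b = b' := by rw [he, hb']
  have hriab : IntegrableOn r (Icc a b) := hri.integrableOn_isCompact isCompact_Icc
  set T : ℝ × Space d ≃ₜ ℝ × Space d := e.prodCongr (Homeomorph.refl _) with hT
  set Tm : ℝ × Space d ≃ᵐ ℝ × Space d := T.toMeasurableEquiv with hTm
  have hTmc : ∀ p, Tm p = (e p.1, p.2) := fun p => rfl
  set lam' : Measure (ℝ × Space d) := lam.map Tm with hlam'
  have : IsFiniteMeasure lam' := Measure.isFiniteMeasure_map _ _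
  -- Only `X` acquires the factor `r`: by the chain rule `∂ₜ(Φ ∘ s) = r (∂ₜΦ) ∘ s`, whereas `𝖣*` and
  -- `Φ` itself are simply transported.
  set X' : ℝ × Space d → Mat n n := fun p => r (Tm.symm p).1 • X (Tm.symm p) with hX'
  set Y' : ℝ × Space d → Mat n k := fun p => Y (Tm.symm p) with hY'
  set Z' : ℝ × Space d → Mat n n := fun p => Z (Tm.symm p) with hZ'
  have hXs : ∀ p, (X' p).IsSymm := fun p => (h.symm _).smul _
  have hce := fun (Φ : ℝ × Space d → Mat n n) (hΦ : IsTestFunction Φ) =>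
    h.continuity_eq_timeChange hab hΩ hμ hGb hC0 hC hrm hriab (s := e)
      (fun t _ => by rw [he t, hea]) hΦ
  -- Any test function serves here; only the integrability of `r X` is extracted.
  have htest : IsTestFunction fun _ : ℝ × Space d => (0 : Mat n n) :=
    ⟨fun _ => by simp [Matrix.IsSymm], fun i j => contDiff_const⟩
  have hrX := (hce _ htest).1
  have hoff : ∀ p, p ∉ timeSpace a' b' Ω → Tm.symm p ∉ timeSpace a b Ω := by
    intro p hp hq
    apply hp
    have : p = (e (Tm.symm p).1, (Tm.symm p).2) := by rw [← hTmc, Tm.apply_symm_apply]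
    rw [this, ← hea, ← heb]
    exact ⟨⟨hmono.monotone hq.1.1, hmono.monotone hq.1.2⟩, hq.2⟩
  have hXoff : ∀ p, p ∉ timeSpace a' b' Ω → X' p = 0 := fun p hp => by
    simp [hX', h.X_off _ (hoff p hp)]
  have hYoff : ∀ p, p ∉ timeSpace a' b' Ω → Y' p = 0 := fun p hp => h.Y_off _ (hoff p hp)
  have hZoff : ∀ p, p ∉ timeSpace a' b' Ω → Z' p = 0 := fun p hp => h.Z_off _ (hoff p hp)
  have hint : ∀ {f : ℝ × Space d → ℝ}, Integrable f lam →
      Integrable (fun p => f (Tm.symm p)) lam' := by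
    intro f hf
    rw [hlam', integrable_map_equiv]
    simpa [Function.comp_def] using hf
  have hdX : WassersteinBures.HasDensity (WassersteinBures.ofDensity lam' X') lam' X' :=
    hasDensity_ofDensity (fun i j => ((hrm.comp measurable_fst).mul (h.G.meas i j)).comp
      Tm.symm.measurable) fun i j => hint (hrX i j)
  have hdY : WassersteinBures.HasDensity (WassersteinBures.ofDensity lam' Y') lam' Y' :=
    hasDensity_ofDensity (fun i j => (h.q.meas i j).comp Tm.symm.measurable)
      fun i j => hint (h.q.int i j)
  have hdZ : WassersteinBures.HasDensity (WassersteinBures.ofDensity lam' Z') lam' Z' :=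
    hasDensity_ofDensity (fun i j => (h.R.meas i j).comp Tm.symm.measurable)
      fun i j => hint (h.R.int i j)
  have hpair : ∀ {p q : ℕ} {W : ℝ × Space d → Mat p q} {Ψ : ℝ × Space d → Mat p q},
      WassersteinBures.HasDensity (WassersteinBures.ofDensity lam' W) lam' W →
      (∀ p, p ∉ timeSpace a' b' Ω → W p = 0) → (∀ i j, Continuous fun p => Ψ p i j) →
      pairing Ψ (WassersteinBures.ofDensity lam' W) =
        ∑ i, ∑ j, ∫ p, Ψ (e p.1, p.2) i j * W (Tm p) i j ∂lam := by
    intro p q W Ψ hW h0 hΨ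
    rw [hW.pairing_eq (fun i j => (hΨ i j).measurable) fun i j =>
      integrable_mul_of_eq_zero_off (isCompact_timeSpace hΩ) (hΨ i j) (hW.int i j)
        (ae_of_all _ fun x hx => by rw [h0 x hx]; rfl)]
    refine Finset.sum_congr rfl fun i _ => Finset.sum_congr rfl fun j _ => ?_
    rw [hlam', integral_map_equiv]
    rfl
  refine ⟨Triple.ofDensity lam' X' Y' Z' hXs, ⟨⟨ofDensity_carriedBy hXoff,
    ofDensity_carriedBy hYoff, ofDensity_carriedBy hZoff⟩, fun Φ hΦ => ?_⟩, ?_⟩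
  · have p1 := hpair hdX hXoff (continuous_timeDeriv hΦ)
    have p2 := hpair hdY hYoff (continuous_spaceDeriv D hΦ)
    have p3 := hpair hdZ hZoff (continuous_entry hΦ)
    have hc := (hce Φ hΦ).2
    simp only [hX', hY', hZ', Tm.symm_apply_apply, Matrix.smul_apply, smul_eq_mul] at p1 p2 p3
    rw [← p1, ← p2, ← p3, hea, heb] at hc
    exact hc
  · have hd : (Triple.ofDensity lam' X' Y' Z' hXs).HasDensity lam' X' Y' Z' := ⟨hdX, hdY, hdZ⟩
    rw [hd.action_eq, hlam', lintegral_map_equiv]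
    refine lintegral_congr fun p => ?_
    simp only [hX', hY', hZ', Tm.symm_apply_apply]
    exact costDensity_scale (hε.trans_le (hr _)) _ _ _

end TimeChange

/-! ### Length and energy -/

lemma lintegral_sqrt_le {a b : ℝ} {f : ℝ → ℝ≥0∞} (hf : Measurable f) :
    ∫⁻ t in Icc a b, f t ^ (1 / 2 : ℝ) ≤
      (ENNReal.ofReal (b - a) * ∫⁻ t in Icc a b, f t) ^ (1 / 2 : ℝ) := by
  have h := ENNReal.lintegral_mul_le_Lp_mul_Lq (volume.restrict (Icc a b))
    Real.HolderConjugate.two_two (hf.pow_const (1 / 2 : ℝ)).aemeasurable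
    (aemeasurable_const (b := (1 : ℝ≥0∞)))
  simp only [Pi.mul_apply, mul_one, ENNReal.one_rpow, lintegral_const, one_mul,
    Measure.restrict_apply_univ, Real.volume_Icc, ← ENNReal.rpow_mul] at h
  norm_num at h ⊢
  rw [mul_comm, ENNReal.mul_rpow_of_nonneg _ _ (by norm_num)]
  exact h

/-- The equality case of the Cauchy-Schwarz inequality `(∫ g)² ≤ (b - a) ∫ g²`. -/
lemma ae_eq_of_sq_integral_eq {a b : ℝ} (hab : a < b) {g : ℝ → ℝ}
    (hg : IntegrableOn g (Icc a b)) (hg2 : IntegrableOn (fun t => g t ^ 2) (Icc a b))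
    (h : (∫ t in Icc a b, g t) ^ 2 = (b - a) * ∫ t in Icc a b, g t ^ 2) :
    ∀ᵐ t ∂(volume.restrict (Icc a b)), (b - a) * g t = ∫ t in Icc a b, g t := by
  set L := ∫ t in Icc a b, g t with hL
  have i1 : Integrable (fun t => (b - a) ^ 2 * g t ^ 2) (volume.restrict (Icc a b)) :=
    hg2.const_mul _
  have i2 : Integrable (fun t => 2 * (b - a) * L * g t) (volume.restrict (Icc a b)) :=
    hg.const_mul _
  have i3 : Integrable (fun t => (b - a) ^ 2 * g t ^ 2 - 2 * (b - a) * L * g t)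
      (volume.restrict (Icc a b)) := i1.sub i2
  have h1 : Integrable (fun t => (b - a) ^ 2 * g t ^ 2 - 2 * (b - a) * L * g t + L ^ 2)
      (volume.restrict (Icc a b)) := i3.add (integrable_const _)
  -- The integrand is `((b - a) g - L)²`, with integral `(b - a) ((b - a) ∫ g² - L²)`.
  have h2 : ∫ t in Icc a b, ((b - a) ^ 2 * g t ^ 2 - 2 * (b - a) * L * g t + L ^ 2) = 0 := by
    rw [integral_add i3 (integrable_const _), integral_sub i1 i2, integral_const_mul,
      integral_const_mul, ← hL, integral_const]
    simp only [measureReal_restrict_apply_univ, Real.volume_real_Icc_of_le hab.le, smul_eq_mul]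
    linear_combination -(b - a) * h
  have h3 := (integral_eq_zero_iff_of_nonneg (fun t => by
    have : (b - a) ^ 2 * g t ^ 2 - 2 * (b - a) * L * g t + L ^ 2 = ((b - a) * g t - L) ^ 2 := by
      ring
    simp only [Pi.zero_apply, this]
    positivity) h1).1 h2
  filter_upwards [h3] with t ht
  have : ((b - a) * g t - L) ^ 2 = 0 := by
    simp only [Pi.zero_apply] at ht
    linarith
  linarith [pow_eq_zero_iff (two_ne_zero) |>.1 this]

section Main

variable {d n k : ℕ} {Λ₁ : Mat k k} {Λ₂ : Mat n n} {Ω : Set (Space d)} {a b : ℝ}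
  {D : DiffOp d n k} {Ga Gb : VectorMeasure (Space d) (Mat n n)} {μ : Triple (ℝ × Space d) n k}
  {lam : Measure (ℝ × Space d)}
  {X : ℝ × Space d → Mat n n} {Y : ℝ × Space d → Mat n k} {Z : ℝ × Space d → Mat n n}

lemma Triple.IsCurveDensity.ae_cost_lt_top [IsFiniteMeasure lam]
    (h : μ.IsCurveDensity Ω a b lam X Y Z) (hμ : action Λ₁ Λ₂ μ < ∞) :
    ∀ᵐ p ∂lam, costDensity Λ₁ Λ₂ (X p) (Y p) (Z p) < ∞ := by
  rw [h.toHasDensity.action_eq] at hμ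
  exact ae_lt_top h.measurable_cost hμ.ne

/-- This serves curves of finite length, whose total action may be infinite. Times at which the
marginal density vanishes carry no mass; at the others a finite slice action makes the cost finite
almost everywhere for the kernel. -/
lemma Triple.IsCurveDensity.ae_cost_lt_top_of_slice [IsFiniteMeasure lam]
    (h : μ.IsCurveDensity Ω a b lam X Y Z) (hac : lam.fst ≪ volume)
    (hf : ∀ᵐ t : ℝ, sliceAction Λ₁ Λ₂ lam X Y Z t < ∞) :
    ∀ᵐ p ∂lam, costDensity Λ₁ Λ₂ (X p) (Y p) (Z p) < ∞ := by
  set E : Set (ℝ × Space d) := {p | costDensity Λ₁ Λ₂ (X p) (Y p) (Z p) = ∞} with hE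
  have hEm : MeasurableSet E := h.measurable_cost (measurableSet_singleton ∞)
  have h0 : lam E = 0 := by
    rw [← lintegral_indicator_one hEm, lintegral_slice hac (measurable_one.indicator hEm)]
    refine (lintegral_congr_ae ?_).trans lintegral_zero
    filter_upwards [hf] with t ht
    by_cases hρ : lam.fst.rnDeriv volume t = 0
    · simp [hρ]
    · have h1 : ∫⁻ x, costDensity Λ₁ Λ₂ (X (t, x)) (Y (t, x)) (Z (t, x)) ∂lam.condKernel t ≠ ∞ := by
        intro h2
        rw [sliceAction, h2, ENNReal.mul_top hρ] at ht
        exact lt_irrefl _ ht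
      have h2 : ∫⁻ x, E.indicator (1 : ℝ × Space d → ℝ≥0∞) (t, x) ∂lam.condKernel t = 0 := by
        refine (lintegral_congr_ae ?_).trans lintegral_zero
        filter_upwards [ae_lt_top (h.measurable_cost_slice t) h1] with x hx
        have hn : (t, x) ∉ E := fun hxE => hx.ne hxE
        simp [hn]
      simp [h2]
  filter_upwards [measure_eq_zero_iff_ae_notMem.1 h0] with p hp
  exact lt_top_iff_ne_top.2 hp

/-- All disintegrations give the same value, so the infimum is attained by the canonical one. -/
lemma Triple.IsCurveDensity.curveLength_eq [IsFiniteMeasure lam]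
    (h : μ.IsCurveDensity Ω a b lam X Y Z) (hac : lam.fst ≪ volume) :
    curveLength Λ₁ Λ₂ Ω a b μ =
      ∫⁻ t in Icc a b, sliceAction Λ₁ Λ₂ lam X Y Z t ^ (1 / 2 : ℝ) := by
  have key : ∀ μt, IsDisintegration Ω a b μ μt →
      ∫⁻ t in Icc a b, action Λ₁ Λ₂ (μt t) ^ (1 / 2 : ℝ) =
      ∫⁻ t in Icc a b, sliceAction Λ₁ Λ₂ lam X Y Z t ^ (1 / 2 : ℝ) := fun μt ht =>
    lintegral_congr_ae ((h.ae_action_eq (Λ₁ := Λ₁) (Λ₂ := Λ₂) hac ht).mono fun t ht => by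
      simp only [ht])
  refine le_antisymm ?_ (le_iInf₂ fun μt ht => (key μt ht).ge)
  exact (iInf₂_le _ (h.isDisintegration_slice hac)).trans (key _ (h.isDisintegration_slice hac)).le

lemma Triple.IsCurveDensity.curveEnergy_eq [IsFiniteMeasure lam]
    (h : μ.IsCurveDensity Ω a b lam X Y Z) (hac : lam.fst ≪ volume) :
    curveEnergy Λ₁ Λ₂ Ω a b μ = ENNReal.ofReal (b - a) * action Λ₁ Λ₂ μ := by
  have key : ∀ μt, IsDisintegration Ω a b μ μt →
      ENNReal.ofReal (b - a) * ∫⁻ t in Icc a b, action Λ₁ Λ₂ (μt t) =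
      ENNReal.ofReal (b - a) * action Λ₁ Λ₂ μ := fun μt ht => by
    rw [h.action_eq_lintegral_slice hac]
    congr 1
    exact lintegral_congr_ae (h.ae_action_eq hac ht)
  refine le_antisymm ?_ (le_iInf₂ fun μt ht => (key μt ht).ge)
  exact (iInf₂_le _ (h.isDisintegration_slice hac)).trans (key _ (h.isDisintegration_slice hac)).le

/-- A curve of finite action, parametrized over another interval. -/
lemma exists_rescale (hΩ : IsCompact Ω) (hD : ∀ x, D.apply (fun _ => 1) x = 0)
    (hGb : CarriedBy Gb Ω) (hab : a < b) (hμ : μ ∈ CE D Ω a b Ga Gb)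
    (hfin : action Λ₁ Λ₂ μ < ∞) {a' b' : ℝ} (hab' : a' < b') :
    ∃ ν ∈ CE D Ω a' b' Ga Gb,
      action Λ₁ Λ₂ ν = ENNReal.ofReal ((b - a) / (b' - a')) * action Λ₁ Λ₂ μ := by
  obtain ⟨X, Y, Z, h⟩ := Triple.exists_isCurveDensity hΩ.measurableSet hμ.1
  obtain ⟨C, hC0, hC⟩ := h.exists_lintegral_bound hab hΩ hD hμ (h.ae_cost_lt_top hfin)
  have h1 : 0 < b - a := sub_pos.2 hab
  have h2 : 0 < b' - a' := sub_pos.2 hab'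
  obtain ⟨ν, hν, hνa⟩ := h.exists_timeChange (Λ₁ := Λ₁) (Λ₂ := Λ₂) hab.le hΩ hμ hGb hC0 hC
    (r := fun _ => (b' - a') / (b - a)) measurable_const (div_pos h2 h1) (fun _ => le_rfl)
    (locallyIntegrable_const _) (a' := a') (b' := b') (by
      rw [intervalIntegral.integral_const, smul_eq_mul, mul_div_cancel₀ _ h1.ne']
      ring)
  refine ⟨ν, hν, ?_⟩
  rw [hνa, lintegral_const_mul _ h.measurable_cost, h.toHasDensity.action_eq, inv_div]

/-- The length of a curve is at most the square root of its energy. -/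
lemma curveLength_le_of_action_lt_top (hΛ₁ : Λ₁.PosSemidef) (hΛ₂ : Λ₂.PosSemidef)
    (hΩ : IsCompact Ω) (hD : ∀ x, D.apply (fun _ => 1) x = 0) (hab : a < b)
    (hμ : μ ∈ CE D Ω a b Ga Gb) (hfin : action Λ₁ Λ₂ μ < ∞) :
    curveLength Λ₁ Λ₂ Ω a b μ ≤ (ENNReal.ofReal (b - a) * action Λ₁ Λ₂ μ) ^ (1 / 2 : ℝ) := by
  obtain ⟨X, Y, Z, h⟩ := Triple.exists_isCurveDensity hΩ.measurableSet hμ.1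
  have hac := h.ac_of_cost_lt_top hab hΛ₁ hΛ₂ hΩ hD hμ (h.ae_cost_lt_top hfin)
  rw [h.curveLength_eq hac, h.action_eq_lintegral_slice hac]
  exact lintegral_sqrt_le h.measurable_sliceAction

/-- Reparametrization by arc length. -/
lemma WB_le_curveLength (hΩ : IsCompact Ω) (hD : ∀ x, D.apply (fun _ => 1) x = 0)
    (hGb : CarriedBy Gb Ω) (hab : a < b) (hμ : μ ∈ CE D Ω a b Ga Gb) :
    WB Λ₁ Λ₂ D Ω Ga Gb ≤ curveLength Λ₁ Λ₂ Ω a b μ := by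
  rcases eq_or_ne (curveLength Λ₁ Λ₂ Ω a b μ) ∞ with htop | hlen
  · simp [htop]
  obtain ⟨X, Y, Z, h⟩ := Triple.exists_isCurveDensity hΩ.measurableSet hμ.1
  obtain ⟨μt, ht⟩ : ∃ μt, IsDisintegration Ω a b μ μt := by
    by_contra hne
    push Not at hne
    -- An infimum over no disintegrations is `∞`.
    exact hlen (by simp [curveLength, hne])
  have hac := h.ac_of_isDisintegration ht
  rw [h.curveLength_eq hac] at hlen ⊢
  set f : ℝ → ℝ≥0∞ := sliceAction Λ₁ Λ₂ μ.ref X Y Z with hf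
  have hfm : Measurable f := h.measurable_sliceAction
  have hf0 : ∀ t, t ∉ Icc a b → f t = 0 := fun t ht => h.sliceAction_eq_zero ht
  have hgm : Measurable fun t => f t ^ (1 / 2 : ℝ) := hfm.pow_const _
  have hall : ∫⁻ t in Icc a b, f t ^ (1 / 2 : ℝ) = ∫⁻ t, f t ^ (1 / 2 : ℝ) :=
    setLIntegral_eq_of_support_subset fun t ht => by
      by_contra h'
      exact ht (by simp [hf0 t h'])
  have hfin : ∀ᵐ t : ℝ, f t < ∞ := by
    filter_upwards [ae_lt_top hgm (hall ▸ hlen)] with t ht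
    by_contra h'
    rw [not_lt, top_le_iff] at h'
    simp [h'] at ht
  obtain ⟨C, hC0, hC⟩ := h.exists_lintegral_bound hab hΩ hD hμ (h.ae_cost_lt_top_of_slice hac hfin)
  set g : ℝ → ℝ := fun t => (f t ^ (1 / 2 : ℝ)).toReal with hg
  have hgi : Integrable g := integrable_toReal_of_lintegral_ne_top hgm.aemeasurable (hall ▸ hlen)
  set L : ℝ := (∫⁻ t in Icc a b, f t ^ (1 / 2 : ℝ)).toReal with hL
  have hLg : ∫ t in a..b, g t = L := by
    rw [intervalIntegral.integral_of_le hab.le, ← integral_Icc_eq_integral_Ioc, hg, hL,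
      integral_toReal hgm.aemeasurable (ae_restrict_of_ae (ae_lt_top hgm (hall ▸ hlen)))]
  have hL0 : 0 ≤ L := ENNReal.toReal_nonneg
  have hba : 0 < b - a := sub_pos.2 hab
  -- The shift by `ε` keeps the time change invertible where the speed `g` vanishes, and also covers
  -- `L = 0`. The constant `c` is the integral of `ε + g`, so the new interval has length one.
  have key : ∀ ε : ℝ, 0 < ε → ⨅ ν ∈ CE D Ω 0 1 Ga Gb, action Λ₁ Λ₂ ν ≤
      ENNReal.ofReal ((L + ε * (b - a)) * L) := by
    intro ε hε
    set c : ℝ := L + ε * (b - a) with hc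
    have hc0 : 0 < c := by positivity
    have hg0 : ∀ t, 0 ≤ g t := fun t => ENNReal.toReal_nonneg
    obtain ⟨ν, hν, hνa⟩ := h.exists_timeChange (Λ₁ := Λ₁) (Λ₂ := Λ₂) hab.le hΩ hμ hGb hC0 hC
      (r := fun t => (ε + g t) / c) ((hgm.ennreal_toReal.const_add ε).div_const c)
      (div_pos hε hc0) (fun t => by
        have := hg0 t
        gcongr
        linarith)
      (by
        have := ((locallyIntegrable_const (μ := (volume : Measure ℝ)) ε).add
          hgi.locallyIntegrable).smul c⁻¹
        refine this.congr (ae_of_all _ fun t => ?_)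
        simp [div_eq_inv_mul]) (a' := 0) (b' := 1) (by
        rw [intervalIntegral.integral_div, intervalIntegral.integral_add
          intervalIntegrable_const hgi.intervalIntegrable, hLg, intervalIntegral.integral_const,
          smul_eq_mul, zero_add, mul_comm, add_comm, div_self hc0.ne'])
    refine (iInf₂_le ν hν).trans ?_
    rw [hνa, h.lintegral_mul_cost hac (g := fun t => ENNReal.ofReal ((ε + g t) / c)⁻¹)
      (((hgm.ennreal_toReal.const_add ε).div_const c).inv.ennreal_ofReal),
      ENNReal.ofReal_mul hc0.le, hL, ENNReal.ofReal_toReal hlen,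
      ← lintegral_const_mul _ hgm]
    refine lintegral_mono_ae (ae_restrict_of_ae ?_)
    filter_upwards [hfin] with t ht
    have hgt : f t ^ (1 / 2 : ℝ) = ENNReal.ofReal (g t) := by
      rw [hg, ENNReal.ofReal_toReal (ENNReal.rpow_ne_top_of_nonneg (by norm_num) ht.ne)]
    have hft : f t = ENNReal.ofReal (g t ^ 2) := by
      rw [ENNReal.ofReal_pow (hg0 t), ← hgt, ← ENNReal.rpow_natCast, ← ENNReal.rpow_mul]
      norm_num
    have hgt0 := hg0 t
    change ENNReal.ofReal ((ε + g t) / c)⁻¹ * f t ≤ ENNReal.ofReal c * f t ^ (1 / 2 : ℝ)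
    rw [hgt, hft, ← ENNReal.ofReal_mul (by positivity), ← ENNReal.ofReal_mul hc0.le]
    refine ENNReal.ofReal_le_ofReal ?_
    rw [inv_div, div_mul_eq_mul_div, div_le_iff₀ (by positivity)]
    -- This is `c g² / (ε + g) ≤ c g`.
    nlinarith [mul_nonneg (mul_nonneg hc0.le hε.le) hgt0]
  have hlim : Tendsto (fun ε : ℝ => ENNReal.ofReal ((L + ε * (b - a)) * L)) (𝓝[>] 0)
      (𝓝 (ENNReal.ofReal ((L + 0 * (b - a)) * L))) := by
    refine (Continuous.tendsto ?_ 0).mono_left nhdsWithin_le_nhds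
    exact ENNReal.continuous_ofReal.comp (by fun_prop)
  have hle := ge_of_tendsto hlim (eventually_mem_nhdsWithin.mono fun ε hε => key ε hε)
  rw [zero_mul, add_zero, ← pow_two, ENNReal.ofReal_pow hL0, hL, ENNReal.ofReal_toReal hlen] at hle
  rw [WB]
  refine (ENNReal.rpow_le_rpow hle (by norm_num : (0 : ℝ) ≤ 1 / 2)).trans ?_
  rw [← ENNReal.rpow_natCast, ← ENNReal.rpow_mul]
  norm_num

/-- Each competitor of finite action on `[0, 1]` is rescaled to `[a, b]`. This divides its action by
`b - a`, which exactly cancels the factor in the Cauchy-Schwarz bound for the length. -/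
lemma iInf_curveLength_le_WB (hΛ₁ : Λ₁.PosSemidef) (hΛ₂ : Λ₂.PosSemidef)
    (hΩ : IsCompact Ω) (hD : ∀ x, D.apply (fun _ => 1) x = 0)
    (hGb : CarriedBy Gb Ω) (hab : a < b) :
    ⨅ μ ∈ CE D Ω a b Ga Gb, curveLength Λ₁ Λ₂ Ω a b μ ≤ WB Λ₁ Λ₂ D Ω Ga Gb := by
  rw [WB, one_div, ENNReal.le_rpow_inv_iff two_pos]
  refine le_iInf₂ fun κ hκ => ?_
  rcases eq_or_ne (action Λ₁ Λ₂ κ) ∞ with htop | hne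
  · simp [htop]
  have hfin := lt_top_iff_ne_top.2 hne
  have hba : 0 < b - a := sub_pos.2 hab
  obtain ⟨ν, hν, hνa⟩ := exists_rescale hΩ hD hGb zero_lt_one hκ hfin hab
  have hνfin : action Λ₁ Λ₂ ν < ∞ := by
    rw [hνa]
    exact ENNReal.mul_lt_top ENNReal.ofReal_lt_top hfin
  rw [← ENNReal.le_rpow_inv_iff two_pos, ← one_div]
  refine (iInf₂_le ν hν).trans
    ((curveLength_le_of_action_lt_top hΛ₁ hΛ₂ hΩ hD hab hν hνfin).trans (le_of_eq ?_))
  rw [hνa, ← mul_assoc, ← ENNReal.ofReal_mul hba.le, sub_zero, mul_one_div_cancel hba.ne']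
  simp

/-- The energy of a minimizer is at most `WB²`. -/
lemma IsEnergyMinimizer.action_le (hΛ₁ : Λ₁.PosSemidef) (hΛ₂ : Λ₂.PosSemidef)
    (hΩ : IsCompact Ω) (hD : ∀ x, D.apply (fun _ => 1) x = 0)
    (hGb : CarriedBy Gb Ω) (hab : a < b) (hμ : IsEnergyMinimizer Λ₁ Λ₂ D Ω a b Ga Gb μ) :
    (ENNReal.ofReal (b - a) * action Λ₁ Λ₂ μ) ^ (1 / 2 : ℝ) ≤ WB Λ₁ Λ₂ D Ω Ga Gb := by
  -- Finite action provides a disintegration, so on `CEfin` minimizing the energy is minimizing the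
  -- action.
  have hE : ∀ ν ∈ CEfin Λ₁ Λ₂ D Ω a b Ga Gb,
      curveEnergy Λ₁ Λ₂ Ω a b ν = ENNReal.ofReal (b - a) * action Λ₁ Λ₂ ν := by
    intro ν hν
    obtain ⟨X, Y, Z, h⟩ := Triple.exists_isCurveDensity hΩ.measurableSet hν.1.1
    exact h.curveEnergy_eq (h.ac_of_cost_lt_top hab hΛ₁ hΛ₂ hΩ hD hν.1 (h.ae_cost_lt_top hν.2))
  refine ENNReal.rpow_le_rpow (le_iInf₂ fun κ hκ => ?_) (by norm_num)
  rcases eq_or_ne (action Λ₁ Λ₂ κ) ∞ with htop | hne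
  · simp [htop]
  have hfin := lt_top_iff_ne_top.2 hne
  have hba : 0 < b - a := sub_pos.2 hab
  obtain ⟨ν, hν, hνa⟩ := exists_rescale hΩ hD hGb zero_lt_one hκ hfin hab
  have hνfin : ν ∈ CEfin Λ₁ Λ₂ D Ω a b Ga Gb := ⟨hν, by
    rw [hνa]
    exact ENNReal.mul_lt_top ENNReal.ofReal_lt_top hfin⟩
  have := hμ.2 ν hνfin
  rw [hE μ hμ.1, hE ν hνfin] at this
  refine this.trans (le_of_eq ?_)
  rw [hνa, ← mul_assoc, ← ENNReal.ofReal_mul hba.le, sub_zero, mul_one_div_cancel hba.ne']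
  simp

/-- Since `WB ≤ length ≤ √energy ≤ WB`, the minimizer attains equality in Cauchy-Schwarz for `√f`
against the constant 1, so its speed is constant almost everywhere. -/
lemma IsEnergyMinimizer.ae_eq (hΛ₁ : Λ₁.PosSemidef) (hΛ₂ : Λ₂.PosSemidef)
    (hΩ : IsCompact Ω) (hD : ∀ x, D.apply (fun _ => 1) x = 0)
    (hGb : CarriedBy Gb Ω) (hab : a < b) (hμ : IsEnergyMinimizer Λ₁ Λ₂ D Ω a b Ga Gb μ) :
    (∃ μt, IsDisintegration Ω a b μ μt) ∧
      ∀ μt, IsDisintegration Ω a b μ μt → ∀ᵐ t ∂(volume.restrict (Icc a b)),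
        ENNReal.ofReal (b - a) * action Λ₁ Λ₂ (μt t) ^ (1 / 2 : ℝ) = WB Λ₁ Λ₂ D Ω Ga Gb := by
  have hle := hμ.action_le hΛ₁ hΛ₂ hΩ hD hGb hab
  have hge := WB_le_curveLength (Λ₁ := Λ₁) (Λ₂ := Λ₂) hΩ hD hGb hab hμ.1.1
  have hmid := curveLength_le_of_action_lt_top hΛ₁ hΛ₂ hΩ hD hab hμ.1.1 hμ.1.2
  obtain ⟨X, Y, Z, h⟩ := Triple.exists_isCurveDensity hΩ.measurableSet hμ.1.1.1
  have hac := h.ac_of_cost_lt_top hab hΛ₁ hΛ₂ hΩ hD hμ.1.1 (h.ae_cost_lt_top hμ.1.2)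
  refine ⟨⟨_, h.isDisintegration_slice hac⟩, fun μt ht => ?_⟩
  have hba : 0 < b - a := sub_pos.2 hab
  have hfin := hμ.1.2
  set W := WB Λ₁ Λ₂ D Ω Ga Gb with hW
  have e1 : curveLength Λ₁ Λ₂ Ω a b μ = W := le_antisymm (hmid.trans hle) hge
  have e2 : (ENNReal.ofReal (b - a) * action Λ₁ Λ₂ μ) ^ (1 / 2 : ℝ) = W :=
    le_antisymm hle (hge.trans hmid)
  have hWfin : W ≠ ∞ := by
    rw [← e2]
    exact ENNReal.rpow_ne_top_of_nonneg (by norm_num)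
      (ENNReal.mul_lt_top ENNReal.ofReal_lt_top hfin).ne
  rw [h.curveLength_eq hac] at e1
  rw [h.action_eq_lintegral_slice hac] at e2 hfin
  set f : ℝ → ℝ≥0∞ := sliceAction Λ₁ Λ₂ μ.ref X Y Z with hf
  have hfm : Measurable f := h.measurable_sliceAction
  have hgm : Measurable fun t => f t ^ (1 / 2 : ℝ) := hfm.pow_const _
  set g : ℝ → ℝ := fun t => (f t ^ (1 / 2 : ℝ)).toReal with hg
  have hg2 : ∀ t, g t ^ 2 = (f t).toReal := fun t => by
    rw [hg, ← ENNReal.toReal_pow, ← ENNReal.rpow_natCast, ← ENNReal.rpow_mul]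
    norm_num
  have i1 : IntegrableOn g (Icc a b) :=
    integrable_toReal_of_lintegral_ne_top hgm.aemeasurable (by rw [e1]; exact hWfin)
  have i2 : IntegrableOn (fun t => g t ^ 2) (Icc a b) := by
    simp only [hg2]
    exact integrable_toReal_of_lintegral_ne_top hfm.aemeasurable hfin.ne
  have hflt := ae_lt_top hfm hfin.ne
  have v1 : ∫ t in Icc a b, g t = W.toReal := by
    rw [hg, integral_toReal hgm.aemeasurable
      (ae_lt_top hgm (by rw [e1]; exact hWfin)), e1]
  have v2 : W.toReal ^ 2 = (b - a) * ∫ t in Icc a b, g t ^ 2 := by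
    simp only [hg2]
    rw [integral_toReal hfm.aemeasurable hflt, ← e2, ← ENNReal.toReal_pow,
      ← ENNReal.rpow_natCast, ← ENNReal.rpow_mul]
    norm_num [hba.le]
  filter_upwards [ae_eq_of_sq_integral_eq hab i1 i2 (by rw [v1, v2]), h.ae_action_eq hac ht, hflt]
    with t t1 t2 t3
  rw [t2]
  have hgt : f t ^ (1 / 2 : ℝ) = ENNReal.ofReal (g t) := by
    rw [hg, ENNReal.ofReal_toReal (ENNReal.rpow_ne_top_of_nonneg (by norm_num) t3.ne)]
  change ENNReal.ofReal (b - a) * f t ^ (1 / 2 : ℝ) = W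
  rw [hgt, ← ENNReal.ofReal_mul hba.le, t1, v1, ENNReal.ofReal_toReal hWfin]

end Main

end WassersteinBures

end

open WassersteinBures
theorem mainTheorem12 {d n k : ℕ}
    (U : Set (Space d)) (hU_open : IsOpen U) (hU_conv : Convex ℝ U) (hU_bdd : Bornology.IsBounded U)
    (Λ₁ : Mat k k) (hΛ₁ : Λ₁.PosSemidef) (Λ₂ : Mat n n) (hΛ₂ : Λ₂.PosDef)
    (D : DiffOp d n k) (hD : ∀ x, D.apply (fun _ => 1) x = 0)
    (G₀ G₁ : VectorMeasure (Space d) (Mat n n))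
    (hG₀ : IsPSDMeasureOn (closure U) G₀) (hG₁ : IsPSDMeasureOn (closure U) G₁)
    (a b : ℝ) (ha : 0 < a) (hab : a < b) :
    WB Λ₁ Λ₂ D (closure U) G₀ G₁
        = (⨅ μ ∈ CE D (closure U) a b G₀ G₁, curveLength Λ₁ Λ₂ (closure U) a b μ) ∧
    ∀ μ, IsEnergyMinimizer Λ₁ Λ₂ D (closure U) a b G₀ G₁ μ →
      (∃ μt, IsDisintegration (closure U) a b μ μt) ∧
      ∀ μt, IsDisintegration (closure U) a b μ μt →
        ∀ᵐ t ∂(volume.restrict (Icc a b)),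
          ENNReal.ofReal (b - a) * action Λ₁ Λ₂ (μt t) ^ (1 / 2 : ℝ)
            = WB Λ₁ Λ₂ D (closure U) G₀ G₁ := by
  have hΩ : IsCompact (closure U) := hU_bdd.isCompact_closure
  refine ⟨le_antisymm (le_iInf₂ fun μ hμ => WB_le_curveLength hΩ hD hG₁.1 hab hμ)
    (iInf_curveLength_le_WB hΛ₁ hΛ₂.posSemidef hΩ hD hG₁.1 hab), fun μ hμ =>
    hμ.ae_eq hΛ₁ hΛ₂.posSemidef hΩ hD hG₁.1 hab⟩
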